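/- Let $\mathbb D=\{z\in\mathbb C:|z|<1\}$. For a weight $\mu$ on $\mathbb D$ (a bounded, continuous, strictly positive function) and $f$ holomorphic on $\mathbb D$ put $\|f\|_\mu=\sup_{z\in\mathbb D}\mu(z)|f'(z)|\in[0,\infty]$. The Bloch-type space $\mathcal B^\mu$ consists of all holomorphic $f$ on $\mathbb D$ with $\|f\|_\mu<\infty$ and carries the norm $|f(0)|+\|f\|_\mu$. For $\alpha\ge 0$ write $\mathcal B^\alpha$ and $\|\cdot\|_\alpha$ when $\mu(z)=(1-|z|^2)^\alpha$, and write $\mathcal B^{\log}$ and $\|\cdot\|_{\log}$ when $\mu(z)=(1-|z|)\log\frac{3}{1-|z|}$. The essential norm $\|T\|_e$ of a bounded linear operator $T:X\to Y$ is the infimum of the operator norms $\|T-K\|$ over all compact linear operators $K:X\to Y$. For a holomorphic $\phi:\mathbb D\to\mathbb D$ let $C_\phi f=f\circ\phi$, and let $F_j(z)=z^j$. **Corollary.** There is an absolute constant $C>0$ such that the following statements hold for every holomorphic $\phi:\mathbb D\to\mathbb D$. 1. For every $\alpha\ge 0$ such that $C_\phi$ is a bounded operator from $\mathcal B^{\log}$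 to $\mathcal B^\alpha$, $$\frac1C\,\|C_\phi\|_e\;\le\;\limsup_{j\to\infty}\frac{\|\phi^j\|_\alpha}{\|F_j\|_{\log}}\;\le\; C\,\|C_\phi\|_e ,$$ and $C_\phi:\mathcal B^{\log}\to\mathcal B^\alpha$ is compact if and only if $\displaystyle\lim_{j\to\infty}\frac{\|\phi^j\|_\alpha}{\|F_j\|_{\log}}=0$. 2. If $C_\phi$ is a bounded operator from $\mathcal B^{\log}$ to $\mathcal B^{\log}$, then $$\frac1C\,\|C_\phi\|_e\;\le\;\limsup_{j\to\infty}\frac{\|\phi^j\|_{\log}}{\|F_j\|_{\log}}\;\le\; C\,\|C_\phi\|_e ,$$ and $C_\phi:\mathcal B^{\log}\to\mathcal B^{\log}$ is compact if and only if $\displaystyle\lim_{j\to\infty}\frac{\|\phi^j\|_{\log}}{\|F_j\|_{\log}}=0$. -/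

import Mathlib

open Filter Topology
open scoped ENNReal NNReal Complex.UnitDisc

noncomputable section

namespace WeightedBloch

/-- The extension by zero to the plane of a function on the open unit disc. It only serves to
express complex differentiability in the disc through Mathlib's derivative on `ℂ`. -/
def toPlane (f : 𝔻 → ℂ) : ℂ → ℂ := fun w =>
  open Classical in if h : ‖w‖ < 1 then f (Complex.UnitDisc.mk w h) else 0

/-- `f` is holomorphic on the open unit disc. -/
def IsHolomorphic (f : 𝔻 → ℂ) : Prop :=
  DifferentiableOn ℂ (toPlane f) (Metric.ball 0 1)

/-- The complex derivative `f'(z)`, `z` in the open unit disc. -/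
def discDeriv (f : 𝔻 → ℂ) (z : 𝔻) : ℂ := deriv (toPlane f) (z : ℂ)

/-- A weight: a bounded, continuous and strictly positive function on the unit disc. -/
structure Weight where
  toFun : 𝔻 → ℝ
  continuous' : Continuous toFun
  pos' : ∀ z, 0 < toFun z
  bounded' : ∃ C, ∀ z, toFun z ≤ C

instance : CoeFun Weight fun _ => 𝔻 → ℝ := ⟨Weight.toFun⟩

/-- The weight `(1 - |z|²)^α`, `α ≥ 0`. -/
def alphaWeight (α : ℝ) (hα : 0 ≤ α) : Weight where
  toFun z := (1 - ‖(z : ℂ)‖ ^ 2) ^ α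
  continuous' := by
    refine Continuous.rpow_const ?_ fun z => Or.inr hα
    exact continuous_const.sub ((Complex.UnitDisc.continuous_coe.norm).pow 2)
  pos' z := Real.rpow_pos_of_pos (sub_pos.2 z.sq_norm_lt_one) _
  bounded' := ⟨1, fun z => Real.rpow_le_one (sub_pos.2 z.sq_norm_lt_one).le
    (by nlinarith [sq_nonneg ‖(z : ℂ)‖]) hα⟩

/-- The logarithmic weight `(1 - |z|) log (3 / (1 - |z|))`. -/
def logWeight : Weight where
  toFun z := (1 - ‖(z : ℂ)‖) * Real.log (3 / (1 - ‖(z : ℂ)‖))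
  continuous' := by
    have hc : Continuous fun z : 𝔻 => 1 - ‖(z : ℂ)‖ :=
      continuous_const.sub Complex.UnitDisc.continuous_coe.norm
    have h0 : ∀ z : 𝔻, 1 - ‖(z : ℂ)‖ ≠ 0 := fun z => (sub_pos.2 z.norm_lt_one).ne'
    exact hc.mul ((continuous_const.div hc h0).log fun z => div_ne_zero (by norm_num) (h0 z))
  pos' z := by
    have h := sub_pos.2 z.norm_lt_one
    refine mul_pos h (Real.log_pos ?_)
    rw [lt_div_iff₀ h]
    linarith [norm_nonneg (z : ℂ)]
  bounded' := ⟨3, fun z => by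
    have h := sub_pos.2 z.norm_lt_one
    calc (1 - ‖(z : ℂ)‖) * Real.log (3 / (1 - ‖(z : ℂ)‖))
        ≤ (1 - ‖(z : ℂ)‖) * (3 / (1 - ‖(z : ℂ)‖)) := by
          gcongr
          exact Real.log_le_self (by positivity)
      _ = 3 := by field_simp⟩

/-- The Bloch semi-norm `‖f‖_μ = sup_z μ(z) |f'(z)|`, with values in `[0, ∞]`. -/
def seminorm (μ : Weight) (f : 𝔻 → ℂ) : ℝ≥0∞ :=
  ⨆ z : 𝔻, ENNReal.ofReal (μ z * ‖discDeriv f z‖)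

/-! Helper facts for the vector space structure and the norm. -/

theorem toPlane_coe (f : 𝔻 → ℂ) (z : 𝔻) : toPlane f z = f z := by
  simp [toPlane, z.norm_lt_one]

theorem toPlane_add (f g : 𝔻 → ℂ) : toPlane (f + g) = toPlane f + toPlane g := by
  funext w
  by_cases h : ‖w‖ < 1 <;> simp [toPlane, h]

theorem toPlane_smul (c : ℂ) (f : 𝔻 → ℂ) : toPlane (c • f) = c • toPlane f := by
  funext w
  by_cases h : ‖w‖ < 1 <;> simp [toPlane, h]

theorem toPlane_zero : toPlane 0 = 0 := by
  funext w
  by_cases h : ‖w‖ < 1 <;> simp [toPlane]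

theorem IsHolomorphic.differentiableAt {f : 𝔻 → ℂ} (hf : IsHolomorphic f) (z : 𝔻) :
    DifferentiableAt ℂ (toPlane f) z :=
  DifferentiableOn.differentiableAt hf
    (Metric.isOpen_ball.mem_nhds (mem_ball_zero_iff.2 z.norm_lt_one))

theorem discDeriv_add {f g : 𝔻 → ℂ} (hf : IsHolomorphic f) (hg : IsHolomorphic g) (z : 𝔻) :
    discDeriv (f + g) z = discDeriv f z + discDeriv g z := by
  rw [discDeriv, toPlane_add, deriv_add (hf.differentiableAt z) (hg.differentiableAt z)]
  rfl

theorem discDeriv_smul (c : ℂ) (f : 𝔻 → ℂ) (z : 𝔻) :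
    discDeriv (c • f) z = c * discDeriv f z := by
  rw [discDeriv, toPlane_smul, deriv_const_smul_field]
  rfl

theorem seminorm_zero (μ : Weight) : seminorm μ 0 = 0 := by
  simp [seminorm, discDeriv, toPlane_zero]

theorem seminorm_add_le (μ : Weight) {f g : 𝔻 → ℂ} (hf : IsHolomorphic f)
    (hg : IsHolomorphic g) : seminorm μ (f + g) ≤ seminorm μ f + seminorm μ g := by
  refine iSup_le fun z => ?_
  have hμ := (μ.pos' z).le
  calc ENNReal.ofReal (μ z * ‖discDeriv (f + g) z‖)
      ≤ ENNReal.ofReal (μ z * ‖discDeriv f z‖ + μ z * ‖discDeriv g z‖) := by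
        rw [discDeriv_add hf hg, ← mul_add]
        gcongr
        exact norm_add_le _ _
    _ = ENNReal.ofReal (μ z * ‖discDeriv f z‖) + ENNReal.ofReal (μ z * ‖discDeriv g z‖) :=
        ENNReal.ofReal_add (by positivity) (by positivity)
    _ ≤ _ := add_le_add (le_iSup (fun z => ENNReal.ofReal (μ z * ‖discDeriv f z‖)) z)
        (le_iSup (fun z => ENNReal.ofReal (μ z * ‖discDeriv g z‖)) z)

theorem seminorm_smul (μ : Weight) (c : ℂ) (f : 𝔻 → ℂ) :
    seminorm μ (c • f) = ENNReal.ofReal ‖c‖ * seminorm μ f := by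
  rw [seminorm, seminorm, ENNReal.mul_iSup]
  refine iSup_congr fun z => ?_
  rw [discDeriv_smul, norm_mul, ← ENNReal.ofReal_mul (norm_nonneg c)]
  congr 1
  ring

/-- The `μ`-Bloch space, as a subspace of the space of all functions on the disc. -/
def blochSubmodule (μ : Weight) : Submodule ℂ (𝔻 → ℂ) where
  carrier := {f | IsHolomorphic f ∧ seminorm μ f < ∞}
  zero_mem' := by
    refine ⟨?_, by simp [seminorm_zero]⟩
    rw [IsHolomorphic, toPlane_zero]
    exact differentiableOn_const 0
  add_mem' := by
    rintro f g ⟨hf, hf'⟩ ⟨hg, hg'⟩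
    refine ⟨?_, (seminorm_add_le μ hf hg).trans_lt (ENNReal.add_lt_top.2 ⟨hf', hg'⟩)⟩
    rw [IsHolomorphic, toPlane_add]
    exact DifferentiableOn.add hf hg
  smul_mem' := by
    rintro c f ⟨hf, hf'⟩
    refine ⟨?_, ?_⟩
    · rw [IsHolomorphic, toPlane_smul]
      exact DifferentiableOn.const_smul hf c
    · rw [seminorm_smul]
      exact ENNReal.mul_lt_top ENNReal.ofReal_lt_top hf'

/-- The `μ`-Bloch space. A separate type, so that its topology is the one of the Bloch norm
and not the topology of pointwise convergence. -/
def BlochSpace (μ : Weight) : Type := ↥(blochSubmodule μ)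

namespace BlochSpace

variable {μ : Weight}

instance : AddCommGroup (BlochSpace μ) := inferInstanceAs (AddCommGroup ↥(blochSubmodule μ))

instance : Module ℂ (BlochSpace μ) := inferInstanceAs (Module ℂ ↥(blochSubmodule μ))

/-- The function on the disc underlying an element of the Bloch space. -/
def toFun (f : BlochSpace μ) : 𝔻 → ℂ := f.1

instance : CoeFun (BlochSpace μ) fun _ => 𝔻 → ℂ := ⟨toFun⟩

/-- The Bloch norm `|f(0)| + ‖f‖_μ`. -/
instance : Norm (BlochSpace μ) := ⟨fun f => ‖f 0‖ + (seminorm μ f).toReal⟩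

theorem isHolomorphic (f : BlochSpace μ) : IsHolomorphic f := f.2.1

theorem seminorm_ne_top (f : BlochSpace μ) : seminorm μ f ≠ ∞ := f.2.2.ne

theorem norm_def (f : BlochSpace μ) : ‖f‖ = ‖f 0‖ + (seminorm μ f).toReal := rfl

theorem toFun_add (f g : BlochSpace μ) : (f + g).toFun = f.toFun + g.toFun := rfl

theorem toFun_smul (c : ℂ) (f : BlochSpace μ) : (c • f).toFun = c • f.toFun := rfl

theorem toFun_injective : Function.Injective (toFun : BlochSpace μ → 𝔻 → ℂ) :=
  Subtype.val_injective

theorem core : NormedSpace.Core ℂ (BlochSpace μ) where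
  norm_nonneg f := by rw [norm_def]; positivity
  norm_smul c f := by
    simp only [norm_def, toFun_smul, seminorm_smul, Pi.smul_apply, norm_smul, ENNReal.toReal_mul,
      ENNReal.toReal_ofReal (norm_nonneg c)]
    ring
  norm_triangle f g := by
    have h := ENNReal.toReal_mono (ENNReal.add_ne_top.2 ⟨f.seminorm_ne_top, g.seminorm_ne_top⟩)
      (seminorm_add_le μ f.isHolomorphic g.isHolomorphic)
    rw [ENNReal.toReal_add f.seminorm_ne_top g.seminorm_ne_top] at h
    have h' := norm_add_le (f 0) (g 0)
    simp only [norm_def, toFun_add, Pi.add_apply]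
    linarith
  norm_eq_zero_iff f := by
    constructor
    · intro h
      rw [norm_def] at h
      have h1 : ‖f 0‖ = 0 := by
        linarith [norm_nonneg (f 0), ENNReal.toReal_nonneg (a := seminorm μ f)]
      have h2 : (seminorm μ f).toReal = 0 := by linarith
      have h3 : seminorm μ f = 0 :=
        ((ENNReal.toReal_eq_zero_iff _).1 h2).resolve_right f.seminorm_ne_top
      have h4 : ∀ z : 𝔻, discDeriv f z = 0 := by
        intro z
        have h5 := (ENNReal.iSup_eq_zero.1 h3) z
        have h6 := ENNReal.ofReal_eq_zero.1 h5
        by_contra h7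
        exact absurd (mul_pos (μ.pos' z) (norm_pos_iff.2 h7)) (not_lt.2 h6)
      apply toFun_injective
      funext z
      have h8 : toPlane f z = toPlane f (0 : 𝔻) := by
        refine (convex_ball (0 : ℂ) 1).is_const_of_fderivWithin_eq_zero (𝕜 := ℂ)
          f.isHolomorphic ?_ (mem_ball_zero_iff.2 z.norm_lt_one)
          (mem_ball_zero_iff.2 (Complex.UnitDisc.norm_lt_one 0))
        intro w hw
        rw [fderivWithin_of_isOpen Metric.isOpen_ball hw]
        have h9 : deriv (toPlane f) w = 0 := h4 (Complex.UnitDisc.mk w (mem_ball_zero_iff.1 hw))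
        ext
        simpa using h9
      rw [toPlane_coe, toPlane_coe, norm_eq_zero.1 h1] at h8
      exact h8
    · rintro rfl
      have h : (0 : BlochSpace μ).toFun = 0 := rfl
      simp [norm_def, h, seminorm_zero]

instance : NormedAddCommGroup (BlochSpace μ) := NormedAddCommGroup.ofCore (𝕜 := ℂ) core

instance : NormedSpace ℂ (BlochSpace μ) := NormedSpace.ofCore core

end BlochSpace

/-- The log-Bloch space. -/
abbrev LogBloch : Type := BlochSpace logWeight

/-- The `α`-Bloch space. -/
abbrev AlphaBloch (α : ℝ) (hα : 0 ≤ α) : Type := BlochSpace (alphaWeight α hα)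

/-- The bounded operator `T` is the composition operator `f ↦ f ∘ φ`. -/
def IsCompositionOperator {μ ν : Weight} (φ : 𝔻 → 𝔻) (T : BlochSpace μ →L[ℂ] BlochSpace ν) :
    Prop :=
  ∀ f : BlochSpace μ, (T f).toFun = f.toFun ∘ φ

/-- The essential norm of a bounded operator: its distance in operator norm from the compact
operators. -/
def essentialNorm {X Y : Type*} [NormedAddCommGroup X] [NormedSpace ℂ X]
    [NormedAddCommGroup Y] [NormedSpace ℂ Y] (T : X →L[ℂ] Y) : ℝ :=
  sInf {r : ℝ | ∃ K : X →L[ℂ] Y, IsCompactOperator K ∧ r = ‖T - K‖}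

/-- The quotient `‖φ ^ j‖_μ / ‖z ^ j‖_log`. -/
def powerRatio (μ : Weight) (φ : 𝔻 → 𝔻) (j : ℕ) : ℝ≥0∞ :=
  seminorm μ (fun z => (φ z : ℂ) ^ j) / seminorm logWeight (fun z => (z : ℂ) ^ j)

end WeightedBloch

end

noncomputable section

namespace WeightedBloch

open BlochSpace

/-! By the chain rule, `C_φ` on the log-Bloch space is governed by the size of `ν(z)|φ'(z)|` against
`logWeight (φ z)` as `φ z` nears the boundary, and monomials detect this quotient. With `t = 1 -
|w|` and `j` about `1 / (2t)`, the weighted derivative of `z ^ j` at `w` is at least a quarter of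
its norm (`exists_norm_monomial_le`). So if the power ratios are at most `Q` for large `j`, then
`ν|φ'| ≤ 4 Q logWeight (φ z)` near the boundary.

Upper bound for the essential norm: Taylor polynomials of dilations give compact `L` with `f - L f`
small on a given smaller disc and of seminorm at most `3‖f‖` (`exists_isCompactOperator_near_id`).
Then `T - T L` has norm at most `4 Q * 3 + ε`, whence the constant 12.

Lower bound: a compact `K` sends the normalized monomials `e_j` to a null sequence. Sparse sums of
any number of them have norm at most 2 (gliding hump), which excludes a nonzero cluster point of `K
e_j`. Hence the limsup of the ratios is at most `‖T - K‖`.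

Compactness follows from `K = T` in one direction, and in the other because norm limits of compact
operators are compact. -/

/-! ### Derivatives on the disc and the chain rule. -/

theorem eqOn_toPlane_of_forall_eq {f : 𝔻 → ℂ} {g : ℂ → ℂ} (h : ∀ z : 𝔻, f z = g z) :
    Set.EqOn (toPlane f) g (Metric.ball 0 1) := by
  intro w hw
  have hw' : ‖w‖ < 1 := mem_ball_zero_iff.1 hw
  simpa [toPlane, hw'] using h (Complex.UnitDisc.mk w hw')

theorem discDeriv_eq_of_forall_eq {f : 𝔻 → ℂ} {g : ℂ → ℂ} (h : ∀ z : 𝔻, f z = g z) (z : 𝔻) :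
    discDeriv f z = deriv g z :=
  ((eqOn_toPlane_of_forall_eq h).eventuallyEq_of_mem
    (Metric.isOpen_ball.mem_nhds (mem_ball_zero_iff.2 z.norm_lt_one))).deriv_eq

theorem isHolomorphic_of_forall_eq {f : 𝔻 → ℂ} {g : ℂ → ℂ} (h : ∀ z : 𝔻, f z = g z)
    (hg : DifferentiableOn ℂ g (Metric.ball 0 1)) : IsHolomorphic f :=
  DifferentiableOn.congr hg (eqOn_toPlane_of_forall_eq h)

theorem IsHolomorphic.hasDerivAt {f : 𝔻 → ℂ} (hf : IsHolomorphic f) (z : 𝔻) :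
    HasDerivAt (toPlane f) (discDeriv f z) z :=
  (hf.differentiableAt z).hasDerivAt

/-- Chain rule on the disc. -/
theorem discDeriv_comp {f : 𝔻 → ℂ} {φ : 𝔻 → 𝔻} (hf : IsHolomorphic f)
    (hφ : IsHolomorphic fun z => (φ z : ℂ)) (z : 𝔻) :
    discDeriv (f ∘ φ) z = discDeriv f (φ z) * discDeriv (fun z => (φ z : ℂ)) z := by
  rw [discDeriv_eq_of_forall_eq (g := toPlane f ∘ toPlane fun z => (φ z : ℂ))
    (fun w => by simp only [Function.comp_apply, toPlane_coe])]
  have h : HasDerivAt (toPlane f) (discDeriv f (φ z)) (toPlane (fun z => (φ z : ℂ)) z) := by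
    rw [toPlane_coe]
    exact hf.hasDerivAt _
  exact (h.comp _ (hφ.hasDerivAt z)).deriv

theorem isHolomorphic_pow (j : ℕ) : IsHolomorphic fun z => (z : ℂ) ^ j :=
  isHolomorphic_of_forall_eq (g := fun w => w ^ j) (fun _ => rfl)
    (differentiable_pow j).differentiableOn

theorem discDeriv_pow (j : ℕ) (z : 𝔻) :
    discDeriv (fun z => (z : ℂ) ^ j) z = j * (z : ℂ) ^ (j - 1) := by
  rw [discDeriv_eq_of_forall_eq (g := fun w => w ^ j) (fun _ => rfl)]
  simp

theorem discDeriv_comp_pow {φ : 𝔻 → 𝔻} (hφ : IsHolomorphic fun z => (φ z : ℂ)) (j : ℕ) (z : 𝔻) :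
    discDeriv (fun z => (φ z : ℂ) ^ j) z =
      j * (φ z : ℂ) ^ (j - 1) * discDeriv (fun z => (φ z : ℂ)) z := by
  rw [← discDeriv_pow]
  exact discDeriv_comp (isHolomorphic_pow j) hφ z

theorem ofReal_le_seminorm (μ : Weight) (f : 𝔻 → ℂ) (z : 𝔻) :
    ENNReal.ofReal (μ z * ‖discDeriv f z‖) ≤ seminorm μ f :=
  le_iSup (fun z => ENNReal.ofReal (μ z * ‖discDeriv f z‖)) z

theorem seminorm_le_ofReal {μ : Weight} {f : 𝔻 → ℂ} {c : ℝ}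
    (h : ∀ z, μ z * ‖discDeriv f z‖ ≤ c) : seminorm μ f ≤ ENNReal.ofReal c :=
  iSup_le fun z => ENNReal.ofReal_le_ofReal (h z)

/-! ### Pointwise bounds and linear functionals on Bloch spaces. -/

namespace BlochSpace

variable {μ : Weight}

/-- A holomorphic function with finite seminorm as an element of the Bloch space. -/
def of (f : 𝔻 → ℂ) (hf : IsHolomorphic f) (h : seminorm μ f < ∞) : BlochSpace μ := ⟨f, hf, h⟩

theorem weight_mul_le_toReal_seminorm (f : BlochSpace μ) (z : 𝔻) :
    μ z * ‖discDeriv f z‖ ≤ (seminorm μ f).toReal :=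
  (ENNReal.ofReal_le_iff_le_toReal f.seminorm_ne_top).1 (ofReal_le_seminorm μ f z)

theorem toReal_seminorm_le_norm (f : BlochSpace μ) : (seminorm μ f).toReal ≤ ‖f‖ := by
  rw [norm_def]
  linarith [norm_nonneg (f 0)]

theorem weight_mul_le_norm (f : BlochSpace μ) (z : 𝔻) : μ z * ‖discDeriv f z‖ ≤ ‖f‖ :=
  (f.weight_mul_le_toReal_seminorm z).trans f.toReal_seminorm_le_norm

theorem seminorm_le_ofReal_norm (f : BlochSpace μ) : seminorm μ f ≤ ENNReal.ofReal ‖f‖ :=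
  seminorm_le_ofReal f.weight_mul_le_norm

theorem norm_apply_zero_le (f : BlochSpace μ) : ‖f 0‖ ≤ ‖f‖ := by
  rw [norm_def]
  linarith [ENNReal.toReal_nonneg (a := seminorm μ f)]

theorem norm_le_of_forall (f : BlochSpace μ) {a c : ℝ} (h0 : ‖f 0‖ ≤ a) (hc : 0 ≤ c)
    (h : ∀ z, μ z * ‖discDeriv f z‖ ≤ c) : ‖f‖ ≤ a + c :=
  add_le_add h0 (ENNReal.toReal_le_of_le_ofReal hc (seminorm_le_ofReal h))

/-- Evaluation at a point, as a linear map. -/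
def evalₗ (z : 𝔻) : BlochSpace μ →ₗ[ℂ] ℂ where
  toFun f := f z
  map_add' _ _ := rfl
  map_smul' _ _ := rfl

theorem evalₗ_apply (z : 𝔻) (f : BlochSpace μ) : evalₗ z f = f z := rfl

/-- The derivative at a point, as a linear map. -/
def discDerivₗ (z : 𝔻) : BlochSpace μ →ₗ[ℂ] ℂ where
  toFun f := discDeriv f z
  map_add' f g := discDeriv_add f.isHolomorphic g.isHolomorphic z
  map_smul' c f := discDeriv_smul c f z

theorem discDerivₗ_apply (z : 𝔻) (f : BlochSpace μ) : discDerivₗ z f = discDeriv f z := rfl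

end BlochSpace

/-! ### Bounds on smaller discs and completeness. -/

theorem isCompact_setOf_norm_le {r : ℝ} (hr : r < 1) : IsCompact {z : 𝔻 | ‖(z : ℂ)‖ ≤ r} := by
  rw [Complex.UnitDisc.isEmbedding_coe.isCompact_iff]
  convert isCompact_closedBall (0 : ℂ) r
  ext w
  simp only [Set.mem_image, Set.mem_ofPred_eq, mem_closedBall_zero_iff]
  exact ⟨fun ⟨z, hz, h⟩ => h ▸ hz, fun hw => ⟨Complex.UnitDisc.mk w (hw.trans_lt hr), hw, rfl⟩⟩

/-- A weight may tend to zero at the boundary, so a positive lower bound comes only from its minimum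
on a compact disc. -/
theorem Weight.exists_pos_le (μ : Weight) {r : ℝ} (hr : r < 1) :
    ∃ c > 0, ∀ z : 𝔻, ‖(z : ℂ)‖ ≤ r → c ≤ μ z := by
  rcases Set.eq_empty_or_nonempty {z : 𝔻 | ‖(z : ℂ)‖ ≤ r} with h | h
  · exact ⟨1, one_pos, fun z hz => absurd (h ▸ hz : z ∈ (∅ : Set 𝔻)) (Set.notMem_empty z)⟩
  · obtain ⟨w, -, hw⟩ := (isCompact_setOf_norm_le hr).exists_isMinOn h μ.continuous'.continuousOn
    exact ⟨μ w, μ.pos' w, fun z hz => hw hz⟩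

/-- The derivatives of a holomorphic function bound its increments from the origin. -/
theorem norm_sub_apply_zero_le {f : 𝔻 → ℂ} (hf : IsHolomorphic f) {r M : ℝ} (hM : 0 ≤ M)
    (h : ∀ z : 𝔻, ‖(z : ℂ)‖ ≤ r → ‖discDeriv f z‖ ≤ M) {z : 𝔻} (hz : ‖(z : ℂ)‖ ≤ r) :
    ‖f z - f 0‖ ≤ M := by
  have hsub : ∀ w ∈ Metric.closedBall (0 : ℂ) ‖(z : ℂ)‖, ‖w‖ < 1 := fun w hw =>
    (mem_closedBall_zero_iff.1 hw).trans_lt z.norm_lt_one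
  have key := (convex_closedBall (0 : ℂ) ‖(z : ℂ)‖).norm_image_sub_le_of_norm_deriv_le
    (f := toPlane f) (C := M) (x := ((0 : 𝔻) : ℂ)) (y := z)
    (fun w hw => hf.differentiableAt (Complex.UnitDisc.mk w (hsub w hw)))
    (fun w hw => h (Complex.UnitDisc.mk w (hsub w hw)) ((mem_closedBall_zero_iff.1 hw).trans hz))
    (by simp) (by simp)
  rw [toPlane_coe, toPlane_coe] at key
  calc ‖f z - f 0‖ ≤ M * ‖(z : ℂ) - ((0 : 𝔻) : ℂ)‖ := key
    _ ≤ M * 1 := by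
      gcongr
      simpa using z.norm_lt_one.le
    _ = M := mul_one M

/-- The Bloch norm controls functions and their derivatives on smaller discs. -/
theorem BlochSpace.exists_norm_discDeriv_le (μ : Weight) {r : ℝ} (hr : r < 1) :
    ∃ M > 0, ∀ (f : BlochSpace μ) (z : 𝔻), ‖(z : ℂ)‖ ≤ r →
      ‖discDeriv f z‖ ≤ M * ‖f‖ ∧ ‖f z‖ ≤ M * ‖f‖ := by
  obtain ⟨c, hc, h⟩ := μ.exists_pos_le hr
  have h1 : ∀ (f : BlochSpace μ) (z : 𝔻), ‖(z : ℂ)‖ ≤ r → ‖discDeriv f z‖ ≤ c⁻¹ * ‖f‖ := by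
    intro f z hz
    rw [inv_mul_eq_div, le_div_iff₀' hc]
    exact (mul_le_mul_of_nonneg_right (h z hz) (norm_nonneg _)).trans (f.weight_mul_le_norm z)
  refine ⟨c⁻¹ + 1, by positivity, fun f z hz => ⟨?_, ?_⟩⟩
  · linarith [h1 f z hz, norm_nonneg f]
  · have h2 := norm_sub_apply_zero_le f.isHolomorphic (M := c⁻¹ * ‖f‖) (by positivity) (h1 f) hz
    have h3 := norm_sub_norm_le (f z) (f 0)
    linarith [f.norm_apply_zero_le]

theorem BlochSpace.toFun_sub {μ : Weight} (f g : BlochSpace μ) :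
    (f - g).toFun = f.toFun - g.toFun := rfl

theorem BlochSpace.discDeriv_sub {μ : Weight} (f g : BlochSpace μ) (z : 𝔻) :
    discDeriv (f - g).toFun z = discDeriv f z - discDeriv g z :=
  map_sub (discDerivₗ z) f g

/-- Completeness of the target space makes the compact operators norm closed. Cauchy sequences
converge locally uniformly, hence so do their derivatives. -/
instance BlochSpace.instCompleteSpace (μ : Weight) : CompleteSpace (BlochSpace μ) := by
  refine Metric.complete_of_cauchySeq_tendsto fun u hu => ?_
  have hcau : ∀ r : ℝ, r < 1 → UniformCauchySeqOn (fun n => toPlane (u n)) atTop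
      (Metric.closedBall 0 r) := by
    intro r hr
    obtain ⟨M, hM, h⟩ := exists_norm_discDeriv_le μ hr
    rw [Metric.uniformCauchySeqOn_iff]
    intro ε hε
    obtain ⟨N, hN⟩ := Metric.cauchySeq_iff.1 hu (ε / M) (by positivity)
    refine ⟨N, fun m hm n hn x hx => ?_⟩
    have hx' := mem_closedBall_zero_iff.1 hx
    have h1 := (h (u m - u n) (Complex.UnitDisc.mk x (hx'.trans_lt hr)) hx').2
    have h2 := hN m hm n hn
    rw [dist_eq_norm, lt_div_iff₀' hM] at h2
    rw [dist_eq_norm]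
    simp only [toPlane, hx'.trans_lt hr, dif_pos]
    exact h1.trans_lt h2
  have hlim : ∀ z : 𝔻, ∃ a, Tendsto (fun n => (u n) z) atTop (𝓝 a) := by
    intro z
    refine cauchySeq_tendsto_of_complete ?_
    have h := (hcau ‖(z : ℂ)‖ z.norm_lt_one).cauchySeq (mem_closedBall_zero_iff.2 le_rfl)
    simpa only [toPlane_coe] using h
  choose g hg using hlim
  have hunif : ∀ r : ℝ, r < 1 → TendstoUniformlyOn (fun n => toPlane (u n)) (toPlane g) atTop
      (Metric.closedBall 0 r) := by
    intro r hr
    refine (hcau r hr).tendstoUniformlyOn_of_tendsto fun x hx => ?_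
    have hx' := (mem_closedBall_zero_iff.1 hx).trans_lt hr
    simp only [toPlane, hx', dif_pos]
    exact hg _
  have hloc : TendstoLocallyUniformlyOn (fun n => toPlane (u n)) (toPlane g) atTop
      (Metric.ball 0 1) := by
    refine tendstoLocallyUniformlyOn_of_forall_exists_nhds fun x hx => ?_
    have hx' := mem_ball_zero_iff.1 hx
    obtain ⟨r, hxr, hr⟩ := exists_between hx'
    exact ⟨Metric.closedBall 0 r, mem_nhdsWithin_of_mem_nhds (Filter.mem_of_superset
      (Metric.isOpen_ball.mem_nhds (mem_ball_zero_iff.2 hxr)) Metric.ball_subset_closedBall),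
      hunif r hr⟩
  have hdiff : ∀ᶠ n in atTop, DifferentiableOn ℂ (toPlane (u n)) (Metric.ball 0 1) :=
    Eventually.of_forall fun n => (u n).isHolomorphic
  have hgh : IsHolomorphic g := hloc.differentiableOn hdiff Metric.isOpen_ball
  have hder : ∀ z : 𝔻, Tendsto (fun n => discDeriv (u n) z) atTop (𝓝 (discDeriv g z)) := fun z =>
    (hloc.deriv hdiff Metric.isOpen_ball).tendsto_at (mem_ball_zero_iff.2 z.norm_lt_one)
  -- Letting `m → ∞` at a fixed point keeps the Cauchy bound, with an `N` that does not depend on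
  -- the point.
  have hbd : ∀ ε > 0, ∃ N, ∀ n ≥ N, ∀ z : 𝔻,
      μ z * ‖discDeriv g z - discDeriv (u n) z‖ ≤ ε := by
    intro ε hε
    obtain ⟨N, hN⟩ := Metric.cauchySeq_iff.1 hu ε hε
    refine ⟨N, fun n hn z => ?_⟩
    refine le_of_tendsto ((((hder z).sub_const (discDeriv (u n) z)).norm).const_mul (μ z)) ?_
    filter_upwards [eventually_ge_atTop N] with m hm
    rw [← discDeriv_sub]
    have := hN m hm n hn
    rw [dist_eq_norm] at this
    exact (weight_mul_le_norm _ z).trans this.le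
  have hgs : seminorm μ g < ∞ := by
    obtain ⟨N, hN⟩ := hbd 1 one_pos
    refine (seminorm_le_ofReal (c := 1 + ‖u N‖) fun z => ?_).trans_lt ENNReal.ofReal_lt_top
    have h1 := hN N le_rfl z
    have h2 := (u N).weight_mul_le_norm z
    have h3 := norm_sub_norm_le (discDeriv g z) (discDeriv (u N) z)
    nlinarith [μ.pos' z]
  refine ⟨of g hgh hgs, ?_⟩
  rw [Metric.tendsto_atTop]
  intro ε hε
  obtain ⟨N, hN⟩ := hbd (ε / 3) (by positivity)
  obtain ⟨N', hN'⟩ := Metric.tendsto_atTop.1 (hg 0) (ε / 3) (by positivity)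
  refine ⟨max N N', fun n hn => ?_⟩
  rw [dist_comm, dist_eq_norm]
  have h := norm_le_of_forall (of g hgh hgs - u n) (a := ε / 3) (c := ε / 3) (by
      rw [toFun_sub, Pi.sub_apply, ← dist_eq_norm, dist_comm]
      exact (hN' n (le_of_max_le_right hn)).le) (by positivity) (fun z => by
      rw [discDeriv_sub]
      exact hN n (le_of_max_le_left hn) z)
  linarith

/-! ### The logarithmic weight. -/

theorem logWeight_apply (z : 𝔻) :
    logWeight z = (1 - ‖(z : ℂ)‖) * Real.log (3 / (1 - ‖(z : ℂ)‖)) := rfl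

theorem logWeight_le_three (z : 𝔻) : logWeight z ≤ 3 := by
  have h := sub_pos.2 z.norm_lt_one
  calc (1 - ‖(z : ℂ)‖) * Real.log (3 / (1 - ‖(z : ℂ)‖))
      ≤ (1 - ‖(z : ℂ)‖) * (3 / (1 - ‖(z : ℂ)‖)) := by
        gcongr
        exact Real.log_le_self (by positivity)
    _ = 3 := by field_simp

/-- The profile `t log (3 / t)` increases on `(0, 1]`. -/
theorem mul_log_three_div_mono {s t : ℝ} (hs : 0 < s) (hst : s ≤ t) (ht : t ≤ 1) :
    s * Real.log (3 / s) ≤ t * Real.log (3 / t) := by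
  have ht0 : 0 < t := hs.trans_le hst
  have h1 : Real.log (3 / s) = Real.log (3 / t) + Real.log (t / s) := by
    rw [← Real.log_mul (by positivity) (by positivity)]
    congr 1
    field_simp
  have h2 : s * Real.log (t / s) ≤ t - s := by
    calc s * Real.log (t / s) ≤ s * (t / s - 1) := by
          gcongr
          exact Real.log_le_sub_one_of_pos (by positivity)
      _ = t - s := by field_simp
  -- The constant 3 in the weight matters here: `3 ≥ e` gives `t - s ≤ (t - s) log (3 / t)`.
  have h3 : 1 ≤ Real.log (3 / t) := by
    rw [Real.le_log_iff_exp_le (by positivity), le_div_iff₀ ht0]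
    nlinarith [Real.exp_one_lt_d9, Real.exp_pos 1]
  rw [h1]
  nlinarith

/-- The logarithmic weight decreases with the modulus. -/
theorem logWeight_anti {z w : 𝔻} (h : ‖(z : ℂ)‖ ≤ ‖(w : ℂ)‖) : logWeight w ≤ logWeight z :=
  mul_log_three_div_mono (sub_pos.2 w.norm_lt_one) (by linarith)
    (by linarith [norm_nonneg (z : ℂ)])

/-- The logarithmic weight tends to zero at the boundary. -/
theorem exists_logWeight_le {ε : ℝ} (hε : 0 < ε) :
    ∃ r < 1, ∀ z : 𝔻, r < ‖(z : ℂ)‖ → logWeight z ≤ ε := by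
  -- Expanding the logarithm turns `t log (3 / t)` into a function continuous at 0.
  have hc : Continuous fun t : ℝ => t * Real.log 3 - t * Real.log t :=
    (continuous_id.mul continuous_const).sub Real.continuous_mul_log
  have h0 := hc.tendsto 0
  simp only [zero_mul, sub_zero] at h0
  obtain ⟨δ, hδ, h⟩ := Metric.eventually_nhds_iff.1 (h0.eventually (gt_mem_nhds hε))
  refine ⟨1 - δ, by linarith, fun z hz => ?_⟩
  have ht := sub_pos.2 z.norm_lt_one
  have h1 := h (y := 1 - ‖(z : ℂ)‖) (by rw [Real.dist_eq, sub_zero, abs_of_pos ht]; linarith)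
  rw [logWeight_apply, Real.log_div three_ne_zero ht.ne', mul_sub]
  exact h1.le

/-! ### Norms of the monomials. -/

theorem norm_discDeriv_pow (j : ℕ) (z : 𝔻) :
    ‖discDeriv (fun z => (z : ℂ) ^ j) z‖ = j * ‖(z : ℂ)‖ ^ (j - 1) := by
  rw [discDeriv_pow, norm_mul, norm_pow, Complex.norm_natCast]

/-- The monomial `z ^ j` as an element of the log-Bloch space. -/
def monomial (j : ℕ) : LogBloch :=
  of (fun z => (z : ℂ) ^ j) (isHolomorphic_pow j) <| by
    refine (seminorm_le_ofReal (c := 3 * (j * 1)) fun z => ?_).trans_lt ENNReal.ofReal_lt_top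
    rw [norm_discDeriv_pow]
    gcongr
    · exact logWeight_le_three z
    · exact pow_le_one₀ (norm_nonneg _) z.norm_lt_one.le

theorem monomial_toFun (j : ℕ) : (monomial j).toFun = fun z : 𝔻 => (z : ℂ) ^ j := rfl

theorem norm_discDeriv_monomial (j : ℕ) (z : 𝔻) :
    ‖discDeriv (monomial j).toFun z‖ = j * ‖(z : ℂ)‖ ^ (j - 1) :=
  norm_discDeriv_pow j z

theorem norm_monomial {j : ℕ} (hj : j ≠ 0) :
    ‖monomial j‖ = (seminorm logWeight fun z => (z : ℂ) ^ j).toReal := by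
  simp [norm_def, monomial_toFun, hj]

theorem seminorm_pow_eq {j : ℕ} (hj : j ≠ 0) :
    seminorm logWeight (fun z => (z : ℂ) ^ j) = ENNReal.ofReal ‖monomial j‖ := by
  rw [norm_monomial hj, ENNReal.ofReal_toReal]
  exact (monomial j).seminorm_ne_top

/-- Each of the `j` terms of the geometric sum is at least `x ^ (j - 1)`, and the sum times `1 - x`
telescopes. -/
theorem natCast_mul_pow_mul_le_one {x : ℝ} (h0 : 0 ≤ x) (h1 : x ≤ 1) (j : ℕ) :
    j * x ^ (j - 1) * (1 - x) ≤ 1 := by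
  have h2 : j * x ^ (j - 1) ≤ ∑ i ∈ Finset.range j, x ^ i := by
    rw [← nsmul_eq_mul]
    simpa using Finset.card_nsmul_le_sum (Finset.range j) (fun i => x ^ i) (x ^ (j - 1))
      fun i hi => pow_le_pow_of_le_one h0 h1 (by have := Finset.mem_range.1 hi; omega)
  calc j * x ^ (j - 1) * (1 - x) ≤ (∑ i ∈ Finset.range j, x ^ i) * (1 - x) :=
        mul_le_mul_of_nonneg_right h2 (sub_nonneg.2 h1)
    _ = 1 - x ^ j := geom_sum_mul_neg x j
    _ ≤ 1 := by linarith [pow_nonneg h0 j]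

/-- The norms of the monomials grow at most logarithmically. -/
theorem norm_monomial_le {j : ℕ} (hj : j ≠ 0) : ‖monomial j‖ ≤ Real.log (3 * j) := by
  have hj1 : (1 : ℝ) ≤ j := by exact_mod_cast Nat.one_le_iff_ne_zero.2 hj
  have hlog : 0 ≤ Real.log (3 * j) := Real.log_nonneg (by linarith)
  rw [← zero_add (Real.log (3 * j))]
  refine norm_le_of_forall _ (by simp [monomial_toFun, hj]) hlog fun z => ?_
  rw [norm_discDeriv_monomial, logWeight_apply]
  have ht := sub_pos.2 z.norm_lt_one
  have ht1 : 1 - ‖(z : ℂ)‖ ≤ 1 := by linarith [norm_nonneg (z : ℂ)]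
  have hp : ‖(z : ℂ)‖ ^ (j - 1) ≤ 1 := pow_le_one₀ (norm_nonneg _) z.norm_lt_one.le
  have hp0 : 0 ≤ ‖(z : ℂ)‖ ^ (j - 1) := by positivity
  -- Within `1 / j` of the boundary the profile is monotone; farther away the logarithm is at most
  -- `log (3 j)` and the geometric sum bounds the rest.
  rcases le_total (1 - ‖(z : ℂ)‖) (1 / j) with h | h
  · have h1 := mul_log_three_div_mono ht h (by rw [div_le_one (by linarith)]; exact hj1)
    rw [div_div_eq_mul_div, div_one] at h1
    calc _ ≤ 1 / (j : ℝ) * Real.log (3 * j) * (j * ‖(z : ℂ)‖ ^ (j - 1)) := by gcongr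
      _ = Real.log (3 * j) * ‖(z : ℂ)‖ ^ (j - 1) := by field_simp
      _ ≤ Real.log (3 * j) * 1 := by gcongr
      _ = _ := mul_one _
  · have h1 : Real.log (3 / (1 - ‖(z : ℂ)‖)) ≤ Real.log (3 * j) := by
      apply Real.log_le_log (by positivity)
      rw [div_le_iff₀ ht]
      rw [div_le_iff₀' (by linarith)] at h
      linarith
    have h2 := natCast_mul_pow_mul_le_one (norm_nonneg (z : ℂ)) z.norm_lt_one.le j
    calc _ = Real.log (3 / (1 - ‖(z : ℂ)‖)) * (j * ‖(z : ℂ)‖ ^ (j - 1) * (1 - ‖(z : ℂ)‖)) := by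
          ring
      _ ≤ Real.log (3 * j) * 1 := by
          gcongr
      _ = _ := mul_one _

/-- Bernoulli's inequality keeps `‖z‖ ^ (j - 1)` above `1 / 2` as long as `j - 1` is at most
half of `1 / (1 - ‖z‖)`. -/
theorem one_half_le_pow {x : ℝ} {j : ℕ} (hx : 0 ≤ x) (h : ((j - 1 : ℕ) : ℝ) * (1 - x) ≤ 1 / 2) :
    1 / 2 ≤ x ^ (j - 1) := by
  have h1 := one_add_mul_le_pow (a := x - 1) (by linarith) (j - 1)
  rw [add_sub_cancel] at h1
  linarith

/-- Test at modulus `1 - 1 / (2 j)`: the power is at least `1 / 2` by Bernoulli and the logarithm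
`log (6 j)` is at least 1. -/
theorem one_fourth_le_norm_monomial {j : ℕ} (hj : j ≠ 0) : 1 / 4 ≤ ‖monomial j‖ := by
  have hj1 : (1 : ℝ) ≤ j := by exact_mod_cast Nat.one_le_iff_ne_zero.2 hj
  have hx0 : (0 : ℝ) ≤ 1 - 1 / (2 * j) := by
    rw [sub_nonneg, div_le_one (by positivity)]
    linarith
  have hx1 : 1 - 1 / (2 * (j : ℝ)) < 1 := by
    have : 0 < 1 / (2 * (j : ℝ)) := by positivity
    linarith
  have hnorm : ‖((1 - 1 / (2 * j) : ℝ) : ℂ)‖ = 1 - 1 / (2 * (j : ℝ)) := by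
    rw [Complex.norm_real, Real.norm_eq_abs, abs_of_nonneg hx0]
  have h1 := (monomial j).weight_mul_le_norm
    (Complex.UnitDisc.mk ((1 - 1 / (2 * j) : ℝ) : ℂ) (hnorm.trans_lt hx1))
  rw [norm_discDeriv_monomial, logWeight_apply, Complex.UnitDisc.coe_mk, hnorm] at h1
  have h2 : 1 / 2 ≤ (1 - 1 / (2 * (j : ℝ))) ^ (j - 1) := by
    refine one_half_le_pow hx0 ?_
    rw [sub_sub_cancel, mul_one_div, div_le_div_iff₀ (by positivity) two_pos]
    have : ((j - 1 : ℕ) : ℝ) ≤ j := by exact_mod_cast Nat.sub_le j 1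
    linarith
  have h3 : 1 ≤ Real.log (3 / (1 - (1 - 1 / (2 * (j : ℝ))))) := by
    rw [Real.le_log_iff_exp_le (by rw [sub_sub_cancel]; positivity), sub_sub_cancel,
      div_div_eq_mul_div, div_one]
    linarith [Real.exp_one_lt_d9]
  refine le_trans ?_ h1
  calc (1 / 4 : ℝ) = 1 / (2 * j) * 1 * (j * (1 / 2)) := by
        field_simp
        norm_num
    _ ≤ _ := by
        rw [sub_sub_cancel] at h3 ⊢
        gcongr

theorem norm_monomial_pos {j : ℕ} (hj : j ≠ 0) : 0 < ‖monomial j‖ :=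
  lt_of_lt_of_le (by norm_num) (one_fourth_le_norm_monomial hj)

/-- Every point near the boundary is a near-maximum point of a monomial of high degree. -/
theorem exists_norm_monomial_le {w : 𝔻} (hw : 1 / 2 ≤ ‖(w : ℂ)‖) :
    ∃ j : ℕ, 1 / (2 * (1 - ‖(w : ℂ)‖)) ≤ j ∧ j ≠ 0 ∧
      ‖monomial j‖ ≤ 4 * logWeight w * (j * ‖(w : ℂ)‖ ^ (j - 1)) := by
  have ht := sub_pos.2 w.norm_lt_one
  set t := 1 - ‖(w : ℂ)‖ with htdef
  have hpos : 0 < 1 / (2 * t) := by positivity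
  have hj := Nat.le_ceil (1 / (2 * t))
  have hj2 := Nat.ceil_lt_add_one hpos.le
  -- The ceiling gives both `j ≥ 1 / (2 t)` and `(j - 1) t ≤ 1 / 2`, the latter for Bernoulli.
  set j := ⌈1 / (2 * t)⌉₊
  have hj0 : j ≠ 0 := fun h => by
    rw [h, Nat.cast_zero] at hj
    linarith
  refine ⟨j, hj, hj0, (norm_monomial_le hj0).trans ?_⟩
  have h1 : 1 / 2 ≤ ‖(w : ℂ)‖ ^ (j - 1) := by
    refine one_half_le_pow (norm_nonneg _) ?_
    rw [Nat.cast_sub (Nat.one_le_iff_ne_zero.2 hj0), Nat.cast_one]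
    calc ((j : ℝ) - 1) * t ≤ 1 / (2 * t) * t := by
          gcongr
          linarith
      _ = 1 / 2 := by field_simp
  have hlog : Real.log (3 * j) ≤ Real.log (3 / t) := by
    have hj1 : (1 : ℝ) ≤ j := by exact_mod_cast Nat.one_le_iff_ne_zero.2 hj0
    apply Real.log_le_log (by positivity)
    -- Here `|w| ≥ 1 / 2` enters, as `1 ≤ 1 / (2 t)`.
    have h2 : 1 / (2 * t) + 1 ≤ 1 / t := by
      rw [show 1 / t = 1 / (2 * t) + 1 / (2 * t) by field_simp; norm_num]
      have : 1 ≤ 1 / (2 * t) := by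
        rw [le_div_iff₀ (by positivity)]
        linarith
      linarith
    calc 3 * (j : ℝ) ≤ 3 * (1 / t) := by
          gcongr
          linarith
      _ = 3 / t := by ring
  have hlog0 : 0 ≤ Real.log (3 / t) := by
    apply Real.log_nonneg
    rw [le_div_iff₀ ht]
    linarith [norm_nonneg (w : ℂ)]
  have hw' : logWeight w = t * Real.log (3 / t) := rfl
  calc Real.log (3 * j) ≤ Real.log (3 / t) := hlog
    -- The 4 compensates two halves: from `j ≥ 1 / (2 t)` and from the power.
    _ = 4 * (t * Real.log (3 / t)) * (1 / (2 * t) * (1 / 2)) := by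
        field_simp
        norm_num
    _ ≤ _ := by
        rw [hw']
        gcongr

/-! ### From power ratios to the derivative of the symbol. -/

/-- A bound for the power ratios of high degree controls the derivative of the symbol near the
boundary. -/
theorem weight_mul_le_of_powerRatio_le {ν : Weight} {φ : 𝔻 → 𝔻}
    (hφ : IsHolomorphic fun z => (φ z : ℂ)) {J : ℕ} {Q : ℝ} (hQ : 0 ≤ Q)
    (h : ∀ j ≥ J, powerRatio ν φ j ≤ ENNReal.ofReal Q) {z : 𝔻} (hz : 1 / 2 ≤ ‖(φ z : ℂ)‖)
    (hJ : (J : ℝ) ≤ 1 / (2 * (1 - ‖(φ z : ℂ)‖))) :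
    ν z * ‖discDeriv (fun z => (φ z : ℂ)) z‖ ≤ 4 * Q * logWeight (φ z) := by
  obtain ⟨j, hj, hj0, hle⟩ := exists_norm_monomial_le hz
  have h1 := h j (by exact_mod_cast hJ.trans hj)
  rw [powerRatio, seminorm_pow_eq hj0, ENNReal.div_le_iff
    (ENNReal.ofReal_pos.2 (norm_monomial_pos hj0)).ne' ENNReal.ofReal_ne_top,
    ← ENNReal.ofReal_mul hQ] at h1
  have h2 := (ENNReal.ofReal_le_ofReal_iff (by positivity)).1 ((ofReal_le_seminorm ν _ z).trans h1)
  rw [discDeriv_comp_pow hφ, norm_mul, norm_mul, norm_pow, Complex.norm_natCast] at h2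
  have h3 : 0 < (j : ℝ) * ‖(φ z : ℂ)‖ ^ (j - 1) := by
    have : (0 : ℝ) < j := by exact_mod_cast Nat.pos_of_ne_zero hj0
    have : 0 < ‖(φ z : ℂ)‖ := by linarith
    positivity
  refine le_of_mul_le_mul_right ?_ h3
  calc _ = ν z * (j * ‖(φ z : ℂ)‖ ^ (j - 1) * ‖discDeriv (fun z => (φ z : ℂ)) z‖) := by ring
    _ ≤ Q * ‖monomial j‖ := h2
    _ ≤ Q * (4 * logWeight (φ z) * (j * ‖(φ z : ℂ)‖ ^ (j - 1))) := by gcongr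
    _ = _ := by ring

/-! ### Taylor coefficients and compact approximation of the identity. -/

/-- The `n`-th Taylor coefficient of the derivative, as a linear map. -/
def taylorCoeffₗ {μ : Weight} (n : ℕ) : BlochSpace μ →ₗ[ℂ] ℂ where
  toFun f := (n.factorial : ℂ)⁻¹ * iteratedDeriv n (deriv (toPlane f)) 0
  map_add' f g := by
    have h : ∀ f : BlochSpace μ, ContDiffAt ℂ (n + 1 : ℕ) (toPlane f) 0 := fun f =>
      (DifferentiableOn.analyticAt f.isHolomorphic
        (Metric.ball_mem_nhds 0 one_pos)).contDiffAt
    simp only [← iteratedDeriv_succ']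
    rw [toFun_add, toPlane_add, iteratedDeriv_add (h f) (h g), mul_add]
  map_smul' c f := by
    simp only [← iteratedDeriv_succ']
    rw [toFun_smul, toPlane_smul, iteratedDeriv_const_smul_field, smul_eq_mul, smul_eq_mul,
      RingHom.id_apply]
    ring

theorem differentiableOn_deriv_toPlane {μ : Weight} (f : BlochSpace μ) :
    DifferentiableOn ℂ (deriv (toPlane f)) (Metric.ball 0 1) :=
  DifferentiableOn.deriv f.isHolomorphic Metric.isOpen_ball

theorem hasSum_taylorCoeff {μ : Weight} (f : BlochSpace μ) (w : 𝔻) :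
    HasSum (fun n => taylorCoeffₗ n f * (w : ℂ) ^ n) (discDeriv f w) := by
  refine (Complex.hasSum_taylorSeries_on_ball (differentiableOn_deriv_toPlane f)
    (mem_ball_zero_iff.2 w.norm_lt_one)).congr_fun fun n => ?_
  simp only [taylorCoeffₗ, LinearMap.coe_mk, AddHom.coe_mk, smul_eq_mul, sub_zero]
  ring

/-- Cauchy's estimate for the Taylor coefficients, uniformly on the Bloch space. -/
theorem exists_norm_taylorCoeff_le (μ : Weight) {R : ℝ} (h0 : 0 < R) (h1 : R < 1) :
    ∃ M > 0, ∀ (f : BlochSpace μ) (n : ℕ), ‖taylorCoeffₗ n f‖ ≤ M * ‖f‖ / R ^ n := by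
  obtain ⟨M, hM, h⟩ := exists_norm_discDeriv_le μ h1
  refine ⟨M, hM, fun f n => ?_⟩
  have hd : DiffContOnCl ℂ (deriv (toPlane f)) (Metric.ball 0 R) :=
    ((differentiableOn_deriv_toPlane f).mono
      (Metric.closedBall_subset_ball h1)).diffContOnCl_ball subset_rfl
  have h2 := Complex.norm_iteratedDeriv_le_of_forall_mem_sphere_norm_le n h0 hd
    (C := M * ‖f‖) fun z hz => by
      have hz' := mem_sphere_zero_iff_norm.1 hz
      exact (h f (Complex.UnitDisc.mk z (hz'.trans_lt h1)) hz'.le).1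
  have hn : (0 : ℝ) < n.factorial := by exact_mod_cast n.factorial_pos
  calc ‖taylorCoeffₗ n f‖ = (n.factorial : ℝ)⁻¹ * ‖iteratedDeriv n (deriv (toPlane f)) 0‖ := by
        simp [taylorCoeffₗ]
    _ ≤ (n.factorial : ℝ)⁻¹ * (n.factorial * (M * ‖f‖) / R ^ n) := by gcongr
    _ = _ := by field_simp

/-- The `n`-th Taylor coefficient of the derivative, as a continuous functional. -/
def taylorCoeff {μ : Weight} (n : ℕ) : BlochSpace μ →L[ℂ] ℂ :=
  (taylorCoeffₗ n).mkContinuousOfExistsBound <| by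
    obtain ⟨M, -, h⟩ := exists_norm_taylorCoeff_le μ one_half_pos one_half_lt_one
    exact ⟨M / (1 / 2) ^ n, fun f => (h f n).trans_eq (by ring)⟩

theorem taylorCoeff_apply {μ : Weight} (n : ℕ) (f : BlochSpace μ) :
    taylorCoeff n f = taylorCoeffₗ n f := rfl

/-- Evaluation at the origin, as a continuous functional. -/
def evalZero {μ : Weight} : BlochSpace μ →L[ℂ] ℂ :=
  (evalₗ 0).mkContinuous 1 fun f => by
    rw [one_mul]
    exact f.norm_apply_zero_le

/-- The Taylor polynomial of the dilation `z ↦ f (r z)`, as a finite rank operator. -/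
def dilatedTaylor (r : ℝ) (N : ℕ) : LogBloch →L[ℂ] LogBloch :=
  evalZero.smulRight (monomial 0) + ∑ n ∈ Finset.range N,
    -- The coefficients belong to `f'`: integrating `z ^ n` divides by `n + 1`, and the dilation
    -- contributes `r ^ (n + 1)`.
    (((r : ℂ) ^ (n + 1) / (n + 1)) • taylorCoeff n).smulRight (monomial (n + 1))

/-- The operator factors through the locally compact space `ℂ`. -/
theorem isCompactOperator_smulRight {X Y : Type*} [NormedAddCommGroup X] [NormedSpace ℂ X]
    [NormedAddCommGroup Y] [NormedSpace ℂ Y] (l : X →L[ℂ] ℂ) (y : Y) :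
    IsCompactOperator (l.smulRight y) := by
  have h : IsCompactOperator ((1 : ℂ →L[ℂ] ℂ).smulRight y) :=
    isCompactOperator_of_locallyCompactSpace_rng _
  have h2 : ⇑(l.smulRight y) = (1 : ℂ →L[ℂ] ℂ).smulRight y ∘ l := by
    funext x
    simp
  rw [h2]
  exact h.comp_clm l

theorem isCompactOperator_dilatedTaylor (r : ℝ) (N : ℕ) :
    IsCompactOperator (dilatedTaylor r N) := by
  have h : dilatedTaylor r N ∈ compactOperator (RingHom.id ℂ) LogBloch LogBloch :=
    Submodule.add_mem _ (isCompactOperator_smulRight _ _)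
      (Submodule.sum_mem _ fun _ _ => isCompactOperator_smulRight _ _)
  exact h

theorem dilatedTaylor_apply (r : ℝ) (N : ℕ) (f : LogBloch) :
    dilatedTaylor r N f = f 0 • monomial 0 + ∑ n ∈ Finset.range N,
      ((r : ℂ) ^ (n + 1) / (n + 1) * taylorCoeffₗ n f) • monomial (n + 1) := by
  simp only [dilatedTaylor, add_apply, sum_apply,
    ContinuousLinearMap.smulRight_apply, smul_apply, smul_eq_mul,
    taylorCoeff_apply]
  rfl

theorem dilatedTaylor_apply_zero (r : ℝ) (N : ℕ) (f : LogBloch) :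
    (dilatedTaylor r N f) 0 = f 0 := by
  rw [← evalₗ_apply, dilatedTaylor_apply, map_add, map_sum]
  simp [evalₗ_apply, monomial_toFun]

theorem discDeriv_dilatedTaylor (r : ℝ) (N : ℕ) (f : LogBloch) (w : 𝔻) :
    discDeriv (dilatedTaylor r N f).toFun w =
      ∑ n ∈ Finset.range N, r * (taylorCoeffₗ n f * (r * w : ℂ) ^ n) := by
  rw [← discDerivₗ_apply, dilatedTaylor_apply, map_add, map_sum]
  simp only [map_smul, discDerivₗ_apply, monomial_toFun, discDeriv_pow, smul_eq_mul]
  rw [Nat.cast_zero, zero_mul, mul_zero, zero_add]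
  refine Finset.sum_congr rfl fun n _ => ?_
  have : (n + 1 : ℂ) ≠ 0 := by exact_mod_cast n.succ_ne_zero
  rw [add_tsub_cancel_right]
  push_cast
  field_simp
  ring

/-- The product of a radius `r ∈ [0, 1]` and a point of the disc. -/
def dilate (r : ℝ) (h0 : 0 ≤ r) (h1 : r ≤ 1) (w : 𝔻) : 𝔻 :=
  Complex.UnitDisc.mk (r * w) <| by
    rw [norm_mul, Complex.norm_real, Real.norm_eq_abs, abs_of_nonneg h0]
    exact (mul_le_of_le_one_left (norm_nonneg _) h1).trans_lt w.norm_lt_one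

theorem norm_dilate (r : ℝ) (h0 : 0 ≤ r) (h1 : r ≤ 1) (w : 𝔻) :
    ‖(dilate r h0 h1 w : ℂ)‖ = r * ‖(w : ℂ)‖ := by
  simp [dilate, abs_of_nonneg h0]

/-- On a smaller disc, the derivatives of the dilations converge, uniformly on the unit ball. -/
theorem exists_dilate_near (μ : Weight) {s ε : ℝ} (hs0 : 0 ≤ s) (hs1 : s < 1) (hε : 0 < ε) :
    ∃ (r : ℝ) (h0 : 0 < r) (h1 : r < 1), ∀ (f : BlochSpace μ) (w : 𝔻), ‖(w : ℂ)‖ ≤ s →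
      ‖discDeriv f w - r * discDeriv f (dilate r h0.le h1.le w)‖ ≤ ε * ‖f‖ := by
  obtain ⟨R, hsR, hR1⟩ := exists_between hs1
  have hR0 : 0 < R := hs0.trans_lt hsR
  obtain ⟨M, hM, hcoeff⟩ := exists_norm_taylorCoeff_le μ hR0 hR1
  have hq0 : 0 ≤ s / R := by positivity
  have hq1 : ‖s / R‖ < 1 := by
    rw [Real.norm_eq_abs, abs_of_nonneg hq0, div_lt_one hR0]
    exact hsR
  have hsum : Summable fun n : ℕ => ((n : ℝ) + 1) * (s / R) ^ n := by
    have h1 := summable_pow_mul_geometric_of_norm_lt_one 1 hq1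
    simpa only [pow_one, add_mul, one_mul] using h1.add (summable_geometric_of_norm_lt_one hq1)
  have hS : 0 ≤ ∑' n : ℕ, ((n : ℝ) + 1) * (s / R) ^ n := tsum_nonneg fun n => by positivity
  set S := ∑' n : ℕ, ((n : ℝ) + 1) * (s / R) ^ n
  -- With `r = 1 - δ`, Bernoulli gives `1 - r ^ (n + 1) ≤ (n + 1) δ`, so the error is at most `M ‖f‖
  -- δ S`. The cap `1 / 2` keeps `r` positive.
  have hδ : 0 < min (1 / 2) (ε / (M * (S + 1))) := lt_min one_half_pos (by positivity)
  set δ := min (1 / 2) (ε / (M * (S + 1)))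
  have hδ1 : δ ≤ 1 / 2 := min_le_left _ _
  have hδ2 : δ * (M * (S + 1)) ≤ ε := (le_div_iff₀ (by positivity)).1 (min_le_right _ _)
  refine ⟨1 - δ, by linarith, by linarith, fun f w hw => ?_⟩
  have hr0 : 0 ≤ 1 - δ := by linarith
  have hr1 : 1 - δ ≤ 1 := by linarith
  have key := (hasSum_taylorCoeff f w).sub
    ((hasSum_taylorCoeff f (dilate (1 - δ) hr0 hr1 w)).mul_left ((1 - δ : ℝ) : ℂ))
  refine (HasSum.norm_le_of_bounded key (hsum.hasSum.mul_left (M * ‖f‖ * δ)) fun n => ?_).trans ?_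
  · have hpow : ‖(1 : ℂ) - ((1 - δ : ℝ) : ℂ) ^ (n + 1)‖ ≤ ((n : ℝ) + 1) * δ := by
      have h1 : (1 - δ) ^ (n + 1) ≤ 1 := pow_le_one₀ hr0 hr1
      have h2 := one_add_mul_le_pow (a := -δ) (by linarith) (n + 1)
      rw [← Complex.ofReal_pow, ← Complex.ofReal_one, ← Complex.ofReal_sub, Complex.norm_real,
        Real.norm_eq_abs, abs_of_nonneg (by linarith)]
      rw [← sub_eq_add_neg] at h2
      push_cast at h2
      linarith
    have heq : taylorCoeffₗ n f * (w : ℂ) ^ n - ((1 - δ : ℝ) : ℂ) *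
        (taylorCoeffₗ n f * (dilate (1 - δ) hr0 hr1 w : ℂ) ^ n) =
        taylorCoeffₗ n f * (w : ℂ) ^ n * (1 - ((1 - δ : ℝ) : ℂ) ^ (n + 1)) := by
      rw [dilate, Complex.UnitDisc.coe_mk]
      ring
    rw [heq, norm_mul, norm_mul, norm_pow]
    calc _ ≤ M * ‖f‖ / R ^ n * s ^ n * (((n : ℝ) + 1) * δ) := by
          gcongr
          exact hcoeff f n
      _ = _ := by
          rw [div_pow]
          ring
  · calc M * ‖f‖ * δ * S ≤ δ * (M * (S + 1)) * ‖f‖ := by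
          nlinarith [mul_nonneg (mul_nonneg hM.le (norm_nonneg f)) hδ.le]
      _ ≤ ε * ‖f‖ := by gcongr

/-- The Taylor polynomials of a dilation converge, uniformly on the disc and on the unit ball. -/
theorem exists_dilatedTaylor_near {r ε : ℝ} (h0 : 0 < r) (h1 : r < 1) (hε : 0 < ε) :
    ∃ N : ℕ, ∀ (f : LogBloch) (w : 𝔻),
      ‖r * discDeriv f (dilate r h0.le h1.le w) - discDeriv (dilatedTaylor r N f).toFun w‖
        ≤ ε * ‖f‖ := by
  obtain ⟨R, hrR, hR1⟩ := exists_between h1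
  have hR0 : 0 < R := h0.trans hrR
  obtain ⟨M, hM, hcoeff⟩ := exists_norm_taylorCoeff_le logWeight hR0 hR1
  have hq0 : 0 ≤ r / R := by positivity
  have hq1 : r / R < 1 := (div_lt_one hR0).2 hrR
  have hq : 0 < 1 - r / R := sub_pos.2 hq1
  -- On the whole disc `|r w| < r < R`, so the tail from `N` on is at most `M ‖f‖ (r / R) ^ N / (1 -
  -- r / R)`.
  obtain ⟨N, hN⟩ := exists_pow_lt_of_lt_one (show 0 < ε * (1 - r / R) / M by positivity) hq1
  refine ⟨N, fun f w => ?_⟩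
  have key := (hasSum_nat_add_iff' N).2
    ((hasSum_taylorCoeff f (dilate r h0.le h1.le w)).mul_left (r : ℂ))
  rw [discDeriv_dilatedTaylor]
  refine (HasSum.norm_le_of_bounded key ((hasSum_geometric_of_lt_one hq0 hq1).mul_left
    (M * ‖f‖ * (r / R) ^ N)) fun n => ?_).trans ?_
  · rw [norm_mul, norm_mul, norm_pow, norm_dilate, Complex.norm_real, Real.norm_eq_abs,
      abs_of_pos h0]
    calc _ ≤ 1 * (M * ‖f‖ / R ^ (n + N) * (r * 1) ^ (n + N)) := by
          have := w.norm_lt_one.le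
          gcongr
          exact hcoeff f _
      _ = _ := by
          rw [div_pow, div_pow, pow_add, pow_add]
          ring
  · rw [lt_div_iff₀ hM] at hN
    calc M * ‖f‖ * (r / R) ^ N * (1 - r / R)⁻¹ = (r / R) ^ N * M * (1 - r / R)⁻¹ * ‖f‖ := by ring
      _ ≤ ε * (1 - r / R) * (1 - r / R)⁻¹ * ‖f‖ := by gcongr
      _ = ε * ‖f‖ := by rw [mul_assoc ε, mul_inv_cancel₀ hq.ne', mul_one]

/-- Compact approximation of the identity of the log-Bloch space: close on a given smaller disc,
and uniformly bounded on the whole disc. -/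
theorem exists_isCompactOperator_near_id {s ε : ℝ} (hs0 : 0 ≤ s) (hs1 : s < 1) (hε : 0 < ε) :
    ∃ L : LogBloch →L[ℂ] LogBloch, IsCompactOperator L ∧ ∀ f : LogBloch,
      (f - L f) 0 = 0 ∧
      (∀ w : 𝔻, ‖(w : ℂ)‖ ≤ s → ‖discDeriv (f - L f).toFun w‖ ≤ ε * ‖f‖) ∧
      ∀ w : 𝔻, logWeight w * ‖discDeriv (f - L f).toFun w‖ ≤ 3 * ‖f‖ := by
  obtain ⟨r, h0, h1, hr⟩ := exists_dilate_near logWeight hs0 hs1 (half_pos hε)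
  obtain ⟨N, hN⟩ := exists_dilatedTaylor_near h0 h1
    -- The `1 / 3` offsets `logWeight ≤ 3`: `f`, its dilation and the Taylor error then contribute
    -- at most `‖f‖` each.
    (show 0 < min (ε / 2) (1 / 3) from lt_min (half_pos hε) (by norm_num))
  refine ⟨dilatedTaylor r N, isCompactOperator_dilatedTaylor r N, fun f => ⟨?_, ?_, ?_⟩⟩
  · rw [toFun_sub, Pi.sub_apply, dilatedTaylor_apply_zero, sub_self]
  · intro w hw
    rw [discDeriv_sub]
    have h2 := hr f w hw
    have h3 := (hN f w).trans (mul_le_mul_of_nonneg_right (min_le_left _ _) (norm_nonneg f))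
    have h4 := norm_sub_le_norm_sub_add_norm_sub (discDeriv f w)
      (r * discDeriv f (dilate r h0.le h1.le w)) (discDeriv (dilatedTaylor r N f).toFun w)
    linarith
  · intro w
    rw [discDeriv_sub]
    have h2 := f.weight_mul_le_norm w
    have h3 := (hN f w).trans (mul_le_mul_of_nonneg_right (min_le_right _ _) (norm_nonneg f))
    have h4 := norm_sub_le_norm_sub_add_norm_sub (discDeriv f w)
      (r * discDeriv f (dilate r h0.le h1.le w)) (discDeriv (dilatedTaylor r N f).toFun w)
    have h5 : logWeight w * ‖(r : ℂ) * discDeriv f (dilate r h0.le h1.le w)‖ ≤ ‖f‖ := by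
      refine le_trans ?_ (f.weight_mul_le_norm (dilate r h0.le h1.le w))
      have h6 : logWeight w ≤ logWeight (dilate r h0.le h1.le w) := by
        refine logWeight_anti ?_
        rw [norm_dilate]
        exact mul_le_of_le_one_left (norm_nonneg _) h1.le
      rw [norm_mul, Complex.norm_real, Real.norm_eq_abs, abs_of_pos h0]
      exact mul_le_mul h6 (mul_le_of_le_one_left (norm_nonneg _) h1.le) (by positivity)
        (logWeight.pos' _).le
    have h7 := norm_sub_le (discDeriv f w) (r * discDeriv f (dilate r h0.le h1.le w))
    have hw := logWeight.pos' w
    have hw3 := logWeight_le_three w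
    calc _ ≤ logWeight w * (‖discDeriv f w‖ + ‖(r : ℂ) * discDeriv f (dilate r h0.le h1.le w)‖
          + 1 / 3 * ‖f‖) := by
          gcongr
          linarith
      _ = logWeight w * ‖discDeriv f w‖ + logWeight w *
          ‖(r : ℂ) * discDeriv f (dilate r h0.le h1.le w)‖ + logWeight w * (1 / 3 * ‖f‖) := by ring
      _ ≤ ‖f‖ + ‖f‖ + 3 * (1 / 3 * ‖f‖) := by gcongr
      _ = 3 * ‖f‖ := by ring

/-! ### Upper bound for the essential norm. -/

theorem bddBelow_essentialNorm_set {X Y : Type*} [NormedAddCommGroup X] [NormedSpace ℂ X]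
    [NormedAddCommGroup Y] [NormedSpace ℂ Y] (T : X →L[ℂ] Y) :
    BddBelow {r : ℝ | ∃ K : X →L[ℂ] Y, IsCompactOperator K ∧ r = ‖T - K‖} := by
  refine ⟨0, ?_⟩
  rintro _ ⟨K, -, rfl⟩
  exact norm_nonneg _

theorem essentialNorm_le_norm_sub {X Y : Type*} [NormedAddCommGroup X] [NormedSpace ℂ X]
    [NormedAddCommGroup Y] [NormedSpace ℂ Y] (T : X →L[ℂ] Y) {K : X →L[ℂ] Y}
    (hK : IsCompactOperator K) : essentialNorm T ≤ ‖T - K‖ :=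
  csInf_le (bddBelow_essentialNorm_set T) ⟨K, hK, rfl⟩

/-- A composition operator is close to the compact operators if the power ratios of high degree
are small. -/
theorem exists_isCompactOperator_norm_sub_le {ν : Weight} {φ : 𝔻 → 𝔻}
    (hφ : IsHolomorphic fun z => (φ z : ℂ)) {T : LogBloch →L[ℂ] BlochSpace ν}
    (hT : IsCompositionOperator φ T) {J : ℕ} {Q ε : ℝ} (hQ : 0 ≤ Q) (hε : 0 < ε)
    (h : ∀ j ≥ J, powerRatio ν φ j ≤ ENNReal.ofReal Q) :
    ∃ K : LogBloch →L[ℂ] BlochSpace ν, IsCompactOperator K ∧ ‖T - K‖ ≤ 12 * Q + ε := by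
  -- The image of the identity function is `φ` itself.
  have hB : ∀ z, ν z * ‖discDeriv (fun z => (φ z : ℂ)) z‖ ≤ ‖T (monomial 1)‖ := by
    intro z
    refine le_of_eq_of_le ?_ ((T (monomial 1)).weight_mul_le_norm z)
    rw [hT, monomial_toFun]
    simp only [pow_one]
    rfl
  set B := ‖T (monomial 1)‖
  have hB0 : 0 ≤ B := norm_nonneg _
  have hJ : (0 : ℝ) < 1 / (2 * (J + 1)) := by positivity
  have hs1 : max (max ‖(φ 0 : ℂ)‖ (1 / 2)) (1 - 1 / (2 * (J + 1))) < 1 :=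
    max_lt (max_lt (φ 0).norm_lt_one one_half_lt_one) (by linarith)
  -- The disc of radius `s` contains `φ 0`; outside it the modulus exceeds `1 / 2` and the test
  -- degree is at least `J`.
  set s := max (max ‖(φ 0 : ℂ)‖ (1 / 2)) (1 - 1 / (2 * ((J : ℝ) + 1)))
  have hsφ : ‖(φ 0 : ℂ)‖ ≤ s := (le_max_left _ _).trans (le_max_left _ _)
  have hs2 : 1 / 2 ≤ s := (le_max_right _ _).trans (le_max_left _ _)
  have hsJ : 1 - 1 / (2 * ((J : ℝ) + 1)) ≤ s := le_max_right _ _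
  have hδ : 0 < ε / (B + 1) := by positivity
  obtain ⟨L, hL, hLf⟩ := exists_isCompactOperator_near_id ((norm_nonneg _).trans hsφ) hs1 hδ
  set δ := ε / (B + 1)
  -- Error budget: `δ` for the value at 0, `δ B` where `|φ z| ≤ s`, and `4 Q * 3` elsewhere.
  have hδB : δ + (12 * Q + δ * B) = 12 * Q + ε := by
    have : δ * (B + 1) = ε := div_mul_cancel₀ _ (by positivity)
    linarith
  refine ⟨T.comp L, hL.clm_comp T, ContinuousLinearMap.opNorm_le_bound _ (by positivity)
    fun f => ?_⟩
  obtain ⟨h0, hin, hout⟩ := hLf f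
  have hsub : (T - T.comp L) f = T (f - L f) := by simp
  rw [hsub, ← hδB, add_mul]
  refine norm_le_of_forall _ ?_ (by positivity) fun z => ?_
  · rw [hT, Function.comp_apply]
    simpa [h0] using norm_sub_apply_zero_le (f - L f).isHolomorphic
      (by positivity : 0 ≤ δ * ‖f‖) hin hsφ
  · rw [hT, discDeriv_comp (f - L f).isHolomorphic hφ, norm_mul]
    rcases le_or_gt ‖(φ z : ℂ)‖ s with hz | hz
    · calc _ = ‖discDeriv (f - L f).toFun (φ z)‖ *
            (ν z * ‖discDeriv (fun z => (φ z : ℂ)) z‖) := by ring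
        _ ≤ δ * ‖f‖ * B :=
            mul_le_mul (hin _ hz) (hB z) (mul_nonneg (ν.pos' z).le (norm_nonneg _)) (by positivity)
        _ ≤ (12 * Q + δ * B) * ‖f‖ := by nlinarith [mul_nonneg hQ (norm_nonneg f)]
    · have ht := sub_pos.2 (φ z).norm_lt_one
      have hJ' : (J : ℝ) ≤ 1 / (2 * (1 - ‖(φ z : ℂ)‖)) := by
        rw [le_div_iff₀ (by positivity)]
        have h1 : 1 - ‖(φ z : ℂ)‖ ≤ 1 / (2 * (J + 1)) := by linarith
        rw [le_div_iff₀ (by positivity)] at h1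
        nlinarith
      have h2 := weight_mul_le_of_powerRatio_le hφ hQ h (hs2.trans hz.le) hJ'
      calc _ = ν z * ‖discDeriv (fun z => (φ z : ℂ)) z‖ *
            ‖discDeriv (f - L f).toFun (φ z)‖ := by ring
        _ ≤ 4 * Q * logWeight (φ z) * ‖discDeriv (f - L f).toFun (φ z)‖ := by gcongr
        _ = 4 * Q * (logWeight (φ z) * ‖discDeriv (f - L f).toFun (φ z)‖) := by ring
        _ ≤ 4 * Q * (3 * ‖f‖) :=
            mul_le_mul_of_nonneg_left (hout _) (by positivity)
        _ ≤ (12 * Q + δ * B) * ‖f‖ := by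
            nlinarith [mul_nonneg (mul_nonneg hδ.le hB0) (norm_nonneg f)]

/-- A value `q` strictly above the limsup and below the claimed bound is finite and eventually
dominates the ratios. -/
theorem essentialNorm_le_limsup {ν : Weight} {φ : 𝔻 → 𝔻}
    (hφ : IsHolomorphic fun z => (φ z : ℂ)) {T : LogBloch →L[ℂ] BlochSpace ν}
    (hT : IsCompositionOperator φ T) :
    (12 : ℝ≥0∞)⁻¹ * ENNReal.ofReal (essentialNorm T) ≤ limsup (powerRatio ν φ) atTop := by
  by_contra! hlt
  obtain ⟨q, hq1, hq2⟩ := exists_between hlt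
  have hq : ENNReal.ofReal q.toReal = q := ENNReal.ofReal_toReal hq2.ne_top
  obtain ⟨J, hJ⟩ := eventually_atTop.1 (eventually_lt_of_limsup_lt hq1)
  have he : essentialNorm T ≤ 12 * q.toReal := by
    refine le_of_forall_pos_le_add fun ε hε => ?_
    obtain ⟨K, hK, hle⟩ := exists_isCompactOperator_norm_sub_le hφ hT ENNReal.toReal_nonneg hε
      fun j hj => (hJ j hj).le.trans_eq hq.symm
    exact (essentialNorm_le_norm_sub T hK).trans hle
  refine hq2.not_ge ?_
  calc (12 : ℝ≥0∞)⁻¹ * ENNReal.ofReal (essentialNorm T)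
      ≤ 12⁻¹ * ENNReal.ofReal (12 * q.toReal) := by gcongr
    _ = 12⁻¹ * (12 * q) := by rw [ENNReal.ofReal_mul (by norm_num), hq]; norm_num
    _ = q := by rw [← mul_assoc, ENNReal.inv_mul_cancel (by norm_num) (by norm_num), one_mul]

theorem isCompactOperator_of_tendsto_powerRatio {ν : Weight} {φ : 𝔻 → 𝔻}
    (hφ : IsHolomorphic fun z => (φ z : ℂ)) {T : LogBloch →L[ℂ] BlochSpace ν}
    (hT : IsCompositionOperator φ T) (h : Tendsto (powerRatio ν φ) atTop (𝓝 0)) :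
    IsCompactOperator T := by
  have hcl : T ∈ closure {K : LogBloch →L[ℂ] BlochSpace ν | IsCompactOperator K} := by
    refine Metric.mem_closure_iff.2 fun ε hε => ?_
    obtain ⟨J, hJ⟩ := eventually_atTop.1
      (h.eventually (gt_mem_nhds (ENNReal.ofReal_pos.2 (show 0 < ε / 48 by positivity))))
    obtain ⟨K, hK, hle⟩ := exists_isCompactOperator_norm_sub_le hφ hT
      (show 0 ≤ ε / 48 by positivity) (half_pos hε) fun j hj => (hJ j hj).le
    exact ⟨K, hK, by rw [dist_eq_norm]; linarith⟩
  rwa [isClosed_setOfPred_isCompactOperator.closure_eq] at hcl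

/-! ### Normalized monomials and the gliding hump. -/

/-- The monomial `z ^ j` divided by its norm in the log-Bloch space. -/
def normalizedMonomial (j : ℕ) : LogBloch := ((‖monomial j‖⁻¹ : ℝ) : ℂ) • monomial j

theorem normalizedMonomial_apply_zero {j : ℕ} (hj : j ≠ 0) : (normalizedMonomial j) 0 = 0 := by
  simp [normalizedMonomial, toFun_smul, monomial_toFun, hj]

theorem norm_normalizedMonomial {j : ℕ} (hj : j ≠ 0) : ‖normalizedMonomial j‖ = 1 := by
  rw [normalizedMonomial, norm_smul, Complex.norm_real, norm_inv, norm_norm,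
    inv_mul_cancel₀ (norm_monomial_pos hj).ne']

theorem norm_discDeriv_normalizedMonomial (j : ℕ) (z : 𝔻) :
    ‖discDeriv (normalizedMonomial j).toFun z‖ =
      ‖monomial j‖⁻¹ * (j * ‖(z : ℂ)‖ ^ (j - 1)) := by
  rw [normalizedMonomial, toFun_smul, discDeriv_smul, norm_mul, norm_discDeriv_monomial,
    Complex.norm_real, norm_inv, norm_norm]

theorem norm_discDeriv_normalizedMonomial_le {j : ℕ} (hj : j ≠ 0) (z : 𝔻) :
    ‖discDeriv (normalizedMonomial j).toFun z‖ ≤ 4 * (j * ‖(z : ℂ)‖ ^ (j - 1)) := by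
  rw [norm_discDeriv_normalizedMonomial]
  gcongr
  rw [inv_le_comm₀ (norm_monomial_pos hj) (by norm_num)]
  linarith [one_fourth_le_norm_monomial hj]

/-- The derivatives of the normalized monomials tend to zero uniformly on smaller discs. -/
theorem eventually_norm_discDeriv_normalizedMonomial_le {r δ : ℝ} (hr0 : 0 ≤ r) (hr1 : r < 1)
    (hδ : 0 < δ) : ∀ᶠ j in atTop, ∀ z : 𝔻, ‖(z : ℂ)‖ ≤ r →
      logWeight z * ‖discDeriv (normalizedMonomial j).toFun z‖ ≤ δ := by
  -- The 12 is 3 from the weight times 4 from the norm bound; `n` stands for `j - 1`.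
  have h1 : Tendsto (fun n : ℕ => 12 * ((n : ℝ) * r ^ n + r ^ n)) atTop (𝓝 0) := by
    simpa using ((tendsto_self_mul_const_pow_of_lt_one hr0 hr1).add
      (tendsto_pow_atTop_nhds_zero_of_lt_one hr0 hr1)).const_mul 12
  have h2 := (tendsto_sub_atTop_nat 1).eventually (h1.eventually (gt_mem_nhds hδ))
  filter_upwards [h2, eventually_ne_atTop 0] with j hj hj0 z hz
  have hc : ((j - 1 : ℕ) : ℝ) + 1 = j := by
    exact_mod_cast Nat.succ_pred_eq_of_ne_zero hj0
  calc _ ≤ 3 * (4 * (j * r ^ (j - 1))) := by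
        refine mul_le_mul (logWeight_le_three z)
          ((norm_discDeriv_normalizedMonomial_le hj0 z).trans ?_) (norm_nonneg _) (by norm_num)
        gcongr
    _ = 12 * (((j - 1 : ℕ) : ℝ) * r ^ (j - 1) + r ^ (j - 1)) := by
        rw [← hc]
        ring
    _ ≤ δ := hj.le

/-- Finite sums of weighted derivatives of normalized monomials vanish at the boundary. -/
theorem exists_sum_normalizedMonomial_le (S : Finset ℕ) (hS : ∀ j ∈ S, j ≠ 0) {δ : ℝ}
    (hδ : 0 < δ) : ∃ r < 1, ∀ z : 𝔻, r < ‖(z : ℂ)‖ →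
      ∑ j ∈ S, logWeight z * ‖discDeriv (normalizedMonomial j).toFun z‖ ≤ δ := by
  have hA : 0 ≤ ∑ j ∈ S, 4 * (j : ℝ) := Finset.sum_nonneg fun j _ => by positivity
  obtain ⟨r, hr, h⟩ := exists_logWeight_le (ε := δ / (∑ j ∈ S, 4 * (j : ℝ) + 1)) (by positivity)
  refine ⟨r, hr, fun z hz => ?_⟩
  have hw := (logWeight.pos' z).le
  calc _ = logWeight z * ∑ j ∈ S, ‖discDeriv (normalizedMonomial j).toFun z‖ := by
        rw [Finset.mul_sum]
    _ ≤ logWeight z * (∑ j ∈ S, 4 * (j : ℝ) + 1) := by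
        gcongr
        refine (Finset.sum_le_sum fun j hj => ?_).trans (le_add_of_nonneg_right zero_le_one)
        refine (norm_discDeriv_normalizedMonomial_le (hS j hj) z).trans ?_
        gcongr
        exact mul_le_of_le_one_right (by positivity)
          (pow_le_one₀ (norm_nonneg _) z.norm_lt_one.le)
    _ ≤ δ / (∑ j ∈ S, 4 * (j : ℝ) + 1) * (∑ j ∈ S, 4 * (j : ℝ) + 1) := by
        gcongr
        exact h z hz
    _ = δ := div_mul_cancel₀ _ (by positivity)

/-- Gliding hump: every infinite set of degrees contains large finite sets of normalized
monomials whose humps barely overlap. -/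
theorem exists_finset_sum_normalizedMonomial_le {p : ℕ → Prop} (hp : ∃ᶠ j in atTop, p j) {δ : ℝ}
    (hδ : 0 < δ) (N : ℕ) : ∃ S : Finset ℕ, S.card = N ∧ (∀ j ∈ S, p j ∧ j ≠ 0) ∧
      ∀ z : 𝔻, ∑ j ∈ S, logWeight z * ‖discDeriv (normalizedMonomial j).toFun z‖ ≤ 1 + N * δ := by
  induction N with
  | zero => exact ⟨∅, rfl, by simp, by simp⟩
  | succ N ih =>
    obtain ⟨S, hcard, hS, hsum⟩ := ih
    obtain ⟨r, hr, hout⟩ := exists_sum_normalizedMonomial_le S (fun j hj => (hS j hj).2) hδ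
    have hin := eventually_norm_discDeriv_normalizedMonomial_le (le_max_right r 0)
      (max_lt hr one_pos) hδ
    obtain ⟨j, hj, hjin, hj0, hjS⟩ := (hp.and_eventually (hin.and ((eventually_ne_atTop 0).and
      (eventually_gt_atTop (S.sup id))))).exists
    have hjS' : j ∉ S := fun h => hjS.not_ge (Finset.le_sup (f := id) h)
    refine ⟨insert j S, by rw [Finset.card_insert_of_notMem hjS', hcard], ?_, fun z => ?_⟩
    · intro i hi
      rcases Finset.mem_insert.1 hi with rfl | hi
      · exact ⟨hj, hj0⟩
      · exact hS i hi
    · rw [Finset.sum_insert hjS']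
      push_cast
      -- Inside, the new hump adds at most `δ`. Outside, the old sum is at most `δ` and the new hump
      -- at most 1.
      rcases le_or_gt ‖(z : ℂ)‖ (max r 0) with hz | hz
      · linarith [hjin z hz, hsum z]
      · have h1 := hout z ((le_max_left _ _).trans_lt hz)
        have h2 := (normalizedMonomial j).weight_mul_le_norm z
        rw [norm_normalizedMonomial hj0] at h2
        nlinarith [(Nat.cast_nonneg N : (0 : ℝ) ≤ N)]

/-- Taking `δ = 1 / N` makes the bound independent of the number of summands. -/
theorem exists_finset_norm_sum_normalizedMonomial_le {p : ℕ → Prop} (hp : ∃ᶠ j in atTop, p j)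
    {N : ℕ} (hN : N ≠ 0) : ∃ S : Finset ℕ, S.card = N ∧ (∀ j ∈ S, p j) ∧
      ‖∑ j ∈ S, normalizedMonomial j‖ ≤ 2 := by
  have hN' : (0 : ℝ) < N := by exact_mod_cast Nat.pos_of_ne_zero hN
  obtain ⟨S, hcard, hS, hsum⟩ :=
    exists_finset_sum_normalizedMonomial_le hp (inv_pos.2 hN') N
  refine ⟨S, hcard, fun j hj => (hS j hj).1, ?_⟩
  rw [← zero_add (2 : ℝ)]
  refine norm_le_of_forall _ ?_ zero_le_two fun z => ?_
  · rw [← evalₗ_apply, map_sum, Finset.sum_eq_zero fun j hj => ?_, norm_zero]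
    exact normalizedMonomial_apply_zero (hS j hj).2
  · rw [← discDerivₗ_apply, map_sum]
    have hw := (logWeight.pos' z).le
    calc _ ≤ logWeight z * ∑ j ∈ S, ‖discDeriv (normalizedMonomial j).toFun z‖ := by
          gcongr
          exact norm_sum_le _ _
      _ ≤ 1 + N * (N : ℝ)⁻¹ := by
          rw [Finset.mul_sum]
          exact hsum z
      _ = 2 := by
          rw [mul_inv_cancel₀ hN'.ne']
          norm_num

/-! ### Lower bound for the essential norm. -/

/-- Compact operators map the normalized monomials to a null sequence. -/
theorem tendsto_norm_compact_normalizedMonomial {Y : Type*} [NormedAddCommGroup Y]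
    [NormedSpace ℂ Y] {K : LogBloch →L[ℂ] Y} (hK : IsCompactOperator K) :
    Tendsto (fun j => ‖K (normalizedMonomial j)‖) atTop (𝓝 0) := by
  by_contra hnot
  obtain ⟨ε, hε, hfreq⟩ : ∃ ε > 0, ∃ᶠ j in atTop, ε ≤ ‖K (normalizedMonomial j)‖ := by
    by_contra! h
    refine hnot (Metric.tendsto_nhds.2 fun ε hε => ?_)
    filter_upwards [h ε hε] with j hj
    simpa using hj
  obtain ⟨Z, hZ, hsub⟩ := IsCompactOperator.image_closedBall_subset_compact
    (f := (K : LogBloch →ₗ[ℂ] Y)) hK 1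
  -- Restricting to indices with large image forces any cluster point to be large too.
  have : (atTop ⊓ 𝓟 {j | ε ≤ ‖K (normalizedMonomial j)‖}).NeBot := frequently_mem_iff_neBot.1 hfreq
  have hmem : ∀ᶠ j in atTop ⊓ 𝓟 {j | ε ≤ ‖K (normalizedMonomial j)‖},
      K (normalizedMonomial j) ∈ Z := by
    refine Eventually.filter_mono inf_le_left ?_
    filter_upwards [eventually_ne_atTop 0] with j hj
    exact hsub ⟨_, mem_closedBall_zero_iff.2 (norm_normalizedMonomial hj).le, rfl⟩
  obtain ⟨y, -, hy⟩ := hZ.exists_mapClusterPt_of_frequently hmem.frequently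
  have hy2 := hy.frequently (Metric.ball_mem_nhds y (show 0 < ε / 4 by positivity))
  have hp : ∃ᶠ j in atTop, K (normalizedMonomial j) ∈ Metric.ball y (ε / 4) :=
    hy2.filter_mono inf_le_left
  have hyε : ε * (3 / 4) ≤ ‖y‖ := by
    obtain ⟨j, hj, hjε⟩ := (hy2.and_eventually
      (Eventually.filter_mono inf_le_right (mem_principal_self _))).exists
    have h1 := mem_ball_iff_norm.1 hj
    have h2 : ε ≤ ‖K (normalizedMonomial j)‖ := hjε
    linarith [norm_sub_norm_le (K (normalizedMonomial j)) y]
  -- The sum of `N` images within `ε / 4` of `y` has norm at least `N ε / 2`, yet at most `2 ‖K‖`.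
  obtain ⟨N, hN⟩ := exists_nat_gt (4 * ‖K‖ / ε)
  have hN0 : (0 : ℝ) < N := lt_of_le_of_lt (by positivity) hN
  obtain ⟨S, hcard, hS, hnorm⟩ := exists_finset_norm_sum_normalizedMonomial_le hp
    (N := N) (by exact_mod_cast hN0.ne')
  have h1 : ‖∑ j ∈ S, K (normalizedMonomial j)‖ ≤ ‖K‖ * 2 := by
    rw [← map_sum]
    exact (K.le_opNorm _).trans (by gcongr)
  have h2 : ‖∑ j ∈ S, (K (normalizedMonomial j) - y)‖ ≤ N * (ε / 4) := by
    rw [← hcard, ← nsmul_eq_mul]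
    exact (norm_sum_le _ _).trans
      (Finset.sum_le_card_nsmul _ _ _ fun j hj => (mem_ball_iff_norm.1 (hS j hj)).le)
  have h3 : (N : ℝ) * ‖y‖ ≤ N * (ε / 4) + ‖K‖ * 2 := by
    have h4 : ‖∑ j ∈ S, y‖ = N * ‖y‖ := by
      rw [Finset.sum_const, hcard, ← Nat.cast_smul_eq_nsmul ℝ, norm_smul, Real.norm_natCast]
    rw [Finset.sum_sub_distrib] at h2
    rw [← h4]
    have h5 := norm_sub_norm_le (∑ j ∈ S, y) (∑ j ∈ S, K (normalizedMonomial j))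
    rw [norm_sub_rev] at h5
    linarith
  rw [div_lt_iff₀ hε] at hN
  nlinarith

/-- Equality can fail because the norm on the right also counts `|φ 0 ^ j|`. -/
theorem powerRatio_le_ofReal_norm {ν : Weight} {φ : 𝔻 → 𝔻} {T : LogBloch →L[ℂ] BlochSpace ν}
    (hT : IsCompositionOperator φ T) {j : ℕ} (hj : j ≠ 0) :
    powerRatio ν φ j ≤ ENNReal.ofReal ‖T (normalizedMonomial j)‖ := by
  have h1 : seminorm ν (fun z => (φ z : ℂ) ^ j) ≤ ENNReal.ofReal ‖T (monomial j)‖ := by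
    refine le_of_eq_of_le ?_ (T (monomial j)).seminorm_le_ofReal_norm
    rw [hT]
    rfl
  have hpos := norm_monomial_pos hj
  calc powerRatio ν φ j ≤ ENNReal.ofReal ‖T (monomial j)‖ / ENNReal.ofReal ‖monomial j‖ := by
        rw [powerRatio, seminorm_pow_eq hj]
        gcongr
    _ = ENNReal.ofReal ‖T (normalizedMonomial j)‖ := by
        rw [← ENNReal.ofReal_div_of_pos hpos, normalizedMonomial, map_smul, norm_smul,
          Complex.norm_real, norm_inv, norm_norm, inv_mul_eq_div]

theorem limsup_le_ofReal_norm_sub {ν : Weight} {φ : 𝔻 → 𝔻} {T K : LogBloch →L[ℂ] BlochSpace ν}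
    (hT : IsCompositionOperator φ T) (hK : IsCompactOperator K) :
    limsup (powerRatio ν φ) atTop ≤ ENNReal.ofReal ‖T - K‖ := by
  have hlim : Tendsto (fun j => ENNReal.ofReal (‖T - K‖ + ‖K (normalizedMonomial j)‖)) atTop
      (𝓝 (ENNReal.ofReal ‖T - K‖)) := by
    simpa using ENNReal.tendsto_ofReal
      ((tendsto_norm_compact_normalizedMonomial hK).const_add ‖T - K‖)
  rw [← hlim.limsup_eq]
  refine limsup_le_limsup ?_
  filter_upwards [eventually_ne_atTop 0] with j hj
  refine (powerRatio_le_ofReal_norm hT hj).trans (ENNReal.ofReal_le_ofReal ?_)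
  have h1 := (T - K).le_opNorm (normalizedMonomial j)
  rw [norm_normalizedMonomial hj, mul_one, sub_apply] at h1
  linarith [norm_sub_norm_le (T (normalizedMonomial j)) (K (normalizedMonomial j))]

theorem limsup_le_essentialNorm {ν : Weight} {φ : 𝔻 → 𝔻} {T : LogBloch →L[ℂ] BlochSpace ν}
    (hT : IsCompositionOperator φ T) :
    limsup (powerRatio ν φ) atTop ≤ ENNReal.ofReal (essentialNorm T) := by
  -- Comparison with `K = 0` shows that the limsup is finite.
  have h0 : IsCompactOperator (0 : LogBloch →L[ℂ] BlochSpace ν) := isCompactOperator_zero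
  have htop : limsup (powerRatio ν φ) atTop ≠ ∞ :=
    ((limsup_le_ofReal_norm_sub hT h0).trans_lt ENNReal.ofReal_lt_top).ne
  rw [← ENNReal.ofReal_toReal htop]
  refine ENNReal.ofReal_le_ofReal (le_csInf ⟨_, 0, h0, rfl⟩ ?_)
  rintro _ ⟨K, hK, rfl⟩
  exact ENNReal.toReal_le_of_le_ofReal (norm_nonneg _) (limsup_le_ofReal_norm_sub hT hK)

theorem tendsto_powerRatio_of_isCompactOperator {ν : Weight} {φ : 𝔻 → 𝔻}
    {T : LogBloch →L[ℂ] BlochSpace ν} (hT : IsCompositionOperator φ T)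
    (h : IsCompactOperator T) : Tendsto (powerRatio ν φ) atTop (𝓝 0) := by
  refine tendsto_of_le_liminf_of_limsup_le zero_le ?_
  simpa using limsup_le_ofReal_norm_sub hT h

/-! ### Both estimates combined. -/

/-- The essential norm estimate and the compactness criterion, for an arbitrary target weight. -/
theorem essentialNorm_estimate {ν : Weight} {φ : 𝔻 → 𝔻}
    (hφ : IsHolomorphic fun z => (φ z : ℂ)) {T : LogBloch →L[ℂ] BlochSpace ν}
    (hT : IsCompositionOperator φ T) :
    (((12 : ℝ≥0) : ℝ≥0∞)⁻¹ * ENNReal.ofReal (essentialNorm T) ≤ limsup (powerRatio ν φ) atTop ∧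
      limsup (powerRatio ν φ) atTop ≤ ((12 : ℝ≥0) : ℝ≥0∞) * ENNReal.ofReal (essentialNorm T)) ∧
    (IsCompactOperator T ↔ Tendsto (powerRatio ν φ) atTop (𝓝 0)) := by
  refine ⟨⟨essentialNorm_le_limsup hφ hT, (limsup_le_essentialNorm hT).trans ?_⟩,
    tendsto_powerRatio_of_isCompactOperator hT, isCompactOperator_of_tendsto_powerRatio hφ hT⟩
  exact le_mul_of_one_le_left zero_le (by norm_num)

end WeightedBloch

end

theorem mainTheorem5 :
    ∃ C : ℝ≥0, 0 < C ∧
      ∀ φ : 𝔻 → 𝔻, WeightedBloch.IsHolomorphic (fun z => (φ z : ℂ)) →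
        (∀ (α : ℝ) (hα : 0 ≤ α)
            (T : WeightedBloch.LogBloch →L[ℂ] WeightedBloch.AlphaBloch α hα),
          WeightedBloch.IsCompositionOperator φ T →
            ((C : ℝ≥0∞)⁻¹ * ENNReal.ofReal (WeightedBloch.essentialNorm T) ≤
                limsup (WeightedBloch.powerRatio (WeightedBloch.alphaWeight α hα) φ) atTop ∧
              limsup (WeightedBloch.powerRatio (WeightedBloch.alphaWeight α hα) φ) atTop ≤
                (C : ℝ≥0∞) * ENNReal.ofReal (WeightedBloch.essentialNorm T)) ∧
            (IsCompactOperator T ↔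
              Tendsto (WeightedBloch.powerRatio (WeightedBloch.alphaWeight α hα) φ)
                atTop (𝓝 0))) ∧
        (∀ T : WeightedBloch.LogBloch →L[ℂ] WeightedBloch.LogBloch,
          WeightedBloch.IsCompositionOperator φ T →
            ((C : ℝ≥0∞)⁻¹ * ENNReal.ofReal (WeightedBloch.essentialNorm T) ≤
                limsup (WeightedBloch.powerRatio WeightedBloch.logWeight φ) atTop ∧
              limsup (WeightedBloch.powerRatio WeightedBloch.logWeight φ) atTop ≤
                (C : ℝ≥0∞) * ENNReal.ofReal (WeightedBloch.essentialNorm T)) ∧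
            (IsCompactOperator T ↔
              Tendsto (WeightedBloch.powerRatio WeightedBloch.logWeight φ)
                atTop (𝓝 0))) := by
  refine ⟨12, by norm_num, fun φ hφ => ⟨fun α hα T hT => ?_, fun T hT => ?_⟩⟩
  · exact WeightedBloch.essentialNorm_estimate hφ hT
  · exact WeightedBloch.essentialNorm_estimate hφ hT
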